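/- **Setting.** Consider an $[[n,k,d]]$ stabilizer code given by $r=n-k$ commuting independent Pauli generators, with distance $d\ge 3$, and let $t=\lfloor (d-1)/2\rfloor\ge 1$. In each round all generators are measured one after the other with Shor circuits: an ancilla cat state is prepared fault-tolerantly ($f$ faults in the preparation cause an error of weight at most $f$ on it), controlled-Pauli gates and transversal Hadamard gates are applied, the ancillas are measured in the $Z$ basis, and the parity of the results gives the syndrome bit. A fault is a (one- or two-qubit) Pauli error after a gate, a bit flip of a single-qubit measurement result, or a fault in a cat state preparation. If $\vec s_1,\dots,\vec s_m$ are the syndromes of the first $m$ rounds, their difference vector is $\vec\delta=\delta_1\dots\delta_{m-1}$, with $\delta_i=0$ if $\vec s_{i+1}=\vec s_i$ and $\delta_i=1$ otherwise. Write $\vec\delta=\eta_1 1\eta_2 1\cdots 1\eta_c$ with (possibly empty) zero strings $\eta_j$ of length $\gamma_j$. Let $\alpha_j$ and $\beta_j$ be the number of non-overlapping substrings $11$ plus the number of remaining ones in the string before, respectively after, $1\eta_j1$ (with $\alpha_1=\beta_c=0$). The zero string $\eta_j$ is *found usable* if $\gamma_j>0$ and $\alpha_j+\beta_j+\gamma_j\ge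 t$. **Protocol (adaptive strong protocol).** Repeat rounds of full syndrome measurements until (1) some $\eta_j$ in the current $\vec\delta$ is found usable; then use the syndrome of any round corresponding to a zero of $\eta_j$; or (2) the number of non-overlapping substrings $11$ in $\vec\delta$ is $t$; then use the syndrome of the latest round. Finally apply a Pauli operator of minimum weight with the chosen syndrome. A protocol is *strongly $t$-fault tolerant* if (ECCP) for every codeword with a Pauli error of weight $w$ as input and $s$ faults with $w+s\le t$, ideally decoding the output gives the same codeword as ideally decoding the input; and (ECRP) for every input state and $s\le t$ faults, the output differs from some codeword by a Pauli error of weight at most $s$. **Theorem.** Let $N(t)=\left(\frac{t+3}{2}\right)^2-1$ if $t$ is odd and $N(t)=\frac{t+2}{2}\cdot\frac{t+4}{2}-1$ if $t$ is even. Then performing at most $N(t)$ rounds is sufficient to guarantee that the protocol is strongly $t$-fault tolerant: whatever syndromes are obtained, a condition to stop is satisfied after at most $N(t)$ rounds, and the protocol so obtained satisfies ECCP and ECRP. Moreover $N(t)\le \frac{(t+3)^2}{4}-1$. The longest binary string $\vec\delta$ such that neither $\vec\delta$ nor any of its prefixes satisfies condition (1) or (2) has length exactly $N(t)-2$, i.e.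 $\left(\frac{t+3}{2}\right)^2-3$ for odd $t$ and $\frac{t+2}{2}\cdot\frac{t+4}{2}-3$ for even $t$. If $t\ge2$, this is also the maximum length of a binary string that contains at least one zero and in which no zero string is found usable. -/

import Mathlib

open scoped Matrix

namespace AdaptiveShor

/-! ### Qubits, Pauli operators, gates -/

/-- The single-qubit Pauli operators. -/
inductive Pauli where
  | I | X | Y | Z
  deriving DecidableEq

/-- The matrix of a single-qubit Pauli operator. -/
noncomputable def Pauli.mat : Pauli → Matrix (Fin 2) (Fin 2) ℂ
  | .I => 1
  | .X => !![0, 1; 1, 0]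
  | .Y => !![0, -Complex.I; Complex.I, 0]
  | .Z => !![1, 0; 0, -1]

/-- The Hadamard gate. -/
noncomputable def hadamard : Matrix (Fin 2) (Fin 2) ℂ :=
  ((1 / Real.sqrt 2 : ℝ) : ℂ) • !![1, 1; 1, -1]

/-- (Unnormalised) state vectors of a register of qubits labelled by `Q`, written in the
computational basis. -/
abbrev State (Q : Type) : Type := (Q → Fin 2) → ℂ

/-- Operators on a register of qubits labelled by `Q`. -/
abbrev Oper (Q : Type) : Type := Matrix (Q → Fin 2) (Q → Fin 2) ℂ

/-- The tensor product of single-qubit operators, one for every qubit of the register. -/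
noncomputable def tensor {Q : Type} [Fintype Q] (A : Q → Matrix (Fin 2) (Fin 2) ℂ) : Oper Q :=
  Matrix.of fun a b => ∏ q, A q (a q) (b q)

/-- A single-qubit operator acting on the qubit `q`. -/
noncomputable def onQubit {Q : Type} [Fintype Q] [DecidableEq Q] (q : Q)
    (A : Matrix (Fin 2) (Fin 2) ℂ) : Oper Q :=
  tensor (Function.update (fun _ => 1) q A)

/-- The controlled-`P` gate with control qubit `c` and target qubit `q`:
`|0⟩⟨0| ⊗ 1 + |1⟩⟨1| ⊗ P`. -/
noncomputable def controlled {Q : Type} [Fintype Q] [DecidableEq Q] (c q : Q) (P : Pauli) :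
    Oper Q :=
  onQubit c !![1, 0; 0, 0] + onQubit c !![0, 0; 0, 1] * onQubit q P.mat

/-- Pauli operators (without phase) on a register: one Pauli letter for each qubit. -/
abbrev PauliString (Q : Type) : Type := Q → Pauli

/-- The operator of a Pauli string. -/
noncomputable def PauliString.op {Q : Type} [Fintype Q] (P : PauliString Q) : Oper Q :=
  tensor fun q => (P q).mat

/-- The weight: the number of qubits on which the Pauli string is not the identity. -/
def PauliString.wt {Q : Type} [Fintype Q] (P : PauliString Q) : ℕ :=
  (Finset.univ.filter fun q => P q ≠ Pauli.I).card

/-! ### Stabilizer codes -/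

/-- A stabilizer code on `n` qubits, given by `r` commuting independent Hermitian Pauli operators
`± P` (so `k = n - r` logical qubits); the group that they generate must not contain `-1`.
(As every generator squares to `1`, the submonoids below are the generated groups.) -/
structure StabilizerCode (n r : ℕ) where
  /-- the Pauli strings of the generators -/
  pauli : Fin r → PauliString (Fin n)
  /-- the signs of the generators, `0` for `+` and `1` for `-` -/
  sign : Fin r → ZMod 2
  comm : ∀ i j, Commute (pauli i).op (pauli j).op
  neg_one_notMem : (-1 : Oper (Fin n)) ∉
    Submonoid.closure (Set.range fun i => (-1 : ℂ) ^ (sign i).val • (pauli i).op)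
  indep : ∀ i, ((-1 : ℂ) ^ (sign i).val • (pauli i).op) ∉
    Submonoid.closure ((fun j => (-1 : ℂ) ^ (sign j).val • (pauli j).op) '' {j | j ≠ i})

namespace StabilizerCode

variable {n r : ℕ} (C : StabilizerCode n r)

/-- The `i`-th stabilizer generator. -/
noncomputable def gen (i : Fin r) : Oper (Fin n) := (-1 : ℂ) ^ (C.sign i).val • (C.pauli i).op

/-- The stabilizer group. -/
noncomputable def stabilizer : Submonoid (Oper (Fin n)) := Submonoid.closure (Set.range C.gen)

/-- The coding subspace, i.e. the simultaneous `+1` eigenspace of the generators, as a predicate. -/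
def IsCodeword (ψ : State (Fin n)) : Prop := ∀ i, C.gen i *ᵥ ψ = ψ

/-- The Pauli string `L` is a nontrivial logical operator: it commutes with the stabilizer, and it
is not in the stabilizer, whatever phase it is given. -/
def IsNontrivialLogical (L : PauliString (Fin n)) : Prop :=
  (∀ i, Commute L.op (C.gen i)) ∧ ∀ c : ℂ, c • L.op ∉ C.stabilizer

/-- The code distance: the minimum weight of a nontrivial logical operator
(with the value `0` if there is none). -/
noncomputable def distance : ℕ := sInf {w | ∃ L, C.IsNontrivialLogical L ∧ L.wt = w}

/-- Syndromes: one bit for each generator, `0` for the eigenvalue `+1` and `1` for `-1`. -/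
abbrev Syndrome (_C : StabilizerCode n r) : Type := Fin r → ZMod 2

/-- The Pauli string `E` has the syndrome `σ`. -/
def HasSyndrome (E : PauliString (Fin n)) (σ : C.Syndrome) : Prop :=
  ∀ i, C.gen i * E.op = (-1 : ℂ) ^ (σ i).val • (E.op * C.gen i)

/-- `E` is an error correction operator for the syndrome `σ`: a Pauli operator of minimum weight
among those with this syndrome. -/
def IsCorrection (σ : C.Syndrome) (E : PauliString (Fin n)) : Prop :=
  C.HasSyndrome E σ ∧ ∀ E', C.HasSyndrome E' σ → E.wt ≤ E'.wt

/-- The projection onto the states with the syndrome `σ`. -/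
noncomputable def syndromeProj (σ : C.Syndrome) : Oper (Fin n) :=
  (List.ofFn fun i => (1 / 2 : ℂ) • (1 + (-1 : ℂ) ^ (σ i).val • C.gen i)).prod

/-- `ψ` is a possible result of ideally decoding `φ`: the syndrome of `φ` is measured without
faults, with a result `σ` of nonzero probability, and a minimum weight correction is applied. -/
def IdealDecode (φ ψ : State (Fin n)) : Prop :=
  ∃ σ E, C.IsCorrection σ E ∧ ψ = E.op *ᵥ (C.syndromeProj σ *ᵥ φ) ∧ ψ ≠ 0

/-- An error correction protocol, seen as the relation `Proto s φ φ'`: an execution with exactly `s`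
faults can turn the state `φ` into the state `φ'`. It is strongly `t`-fault tolerant if
* (ECCP) whenever a codeword with an error of weight `w` is the input and `w + s ≤ t`, ideally
  decoding the output gives the same codeword (up to a scalar) as ideally decoding the input;
* (ECRP) whenever `s ≤ t`, the output differs from some codeword by an error of weight at most `s`,
  for an arbitrary input state. -/
def StronglyFaultTolerant (t : ℕ) (Proto : ℕ → State (Fin n) → State (Fin n) → Prop) : Prop :=
  t ≤ (C.distance - 1) / 2 ∧
  (∀ (s : ℕ) (E : PauliString (Fin n)) (ψ φ' : State (Fin n)),
    C.IsCodeword ψ → ψ ≠ 0 → E.wt + s ≤ t → Proto s (E.op *ᵥ ψ) φ' →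
    ∀ ψ₁ ψ₂, C.IdealDecode (E.op *ᵥ ψ) ψ₁ → C.IdealDecode φ' ψ₂ →
      ∃ c : ℂ, c ≠ 0 ∧ ψ₂ = c • ψ₁) ∧
  (∀ (s : ℕ) (φ φ' : State (Fin n)), s ≤ t → Proto s φ φ' →
    ∃ (ψ : State (Fin n)) (E : PauliString (Fin n)),
      C.IsCodeword ψ ∧ E.wt ≤ s ∧ φ' = E.op *ᵥ ψ)

end StabilizerCode

/-! ### The Shor syndrome extraction circuit with faults -/

/-- The qubits on which `P` is not the identity. There is one ancilla qubit for each of them. -/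
abbrev Supp {n : ℕ} (P : PauliString (Fin n)) : Type := {q : Fin n // P q ≠ Pauli.I}

/-- The faults in one run of the Shor circuit that measures `P`. -/
structure Faults {n : ℕ} (P : PauliString (Fin n)) where
  /-- the Pauli error by which the prepared state differs from the ideal cat state -/
  prep : PauliString (Supp P)
  /-- the two-qubit Pauli errors (data, ancilla) after the controlled Pauli gates -/
  ctrl : Supp P → Pauli × Pauli
  /-- the Pauli errors after the Hadamard gates -/
  had : PauliString (Supp P)
  /-- the bit flips after the single-qubit measurements -/
  flip : Supp P → ZMod 2

/-- The number of faults. The cat state is prepared fault-tolerantly, so an error of weight `w` on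
it takes (at least) `w` faults in its preparation; otherwise every location with a nontrivial error
is a fault. -/
def Faults.count {n : ℕ} {P : PauliString (Fin n)} (f : Faults P) : ℕ :=
  f.prep.wt + (Finset.univ.filter fun c => f.ctrl c ≠ (Pauli.I, Pauli.I)).card
    + f.had.wt + (Finset.univ.filter fun c => f.flip c ≠ 0).card

/-- The cat state `(|0…0⟩ + |1…1⟩) / √2`. -/
noncomputable def cat (A : Type) [Fintype A] : State A := fun a =>
  ((1 / Real.sqrt 2 : ℝ) : ℂ) *
    ((if ∀ c, a c = 0 then 1 else 0) + (if ∀ c, a c = 1 then 1 else 0))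

/-- The product of a state of the data qubits and a state of the ancilla qubits. -/
def joint {D A : Type} (φ : State D) (χ : State A) : State (D ⊕ A) := fun a =>
  φ (fun q => a (Sum.inl q)) * χ (fun c => a (Sum.inr c))

/-- The support of `P`, in the order in which the controlled gates are applied. -/
def suppList {n : ℕ} (P : PauliString (Fin n)) : List (Supp P) :=
  (List.finRange n).filterMap fun q => if h : P q ≠ Pauli.I then some ⟨q, h⟩ else none

/-- The state of data and ancillas just before the single-qubit measurements: a (faulty) cat state
is prepared, for each qubit of the support a controlled Pauli gate from the ancilla to the data
qubit is applied, and then the Hadamard gates on the ancillas; every gate is followed by its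
error. -/
noncomputable def beforeMeasurement {n : ℕ} (P : PauliString (Fin n)) (f : Faults P)
    (φ : State (Fin n)) : State (Fin n ⊕ Supp P) :=
  let χ₀ : State (Fin n ⊕ Supp P) := joint φ (f.prep.op *ᵥ cat (Supp P))
  let χ₁ := (suppList P).foldl (fun χ c =>
    (onQubit (Sum.inl c.1) (f.ctrl c).1.mat * onQubit (Sum.inr c) (f.ctrl c).2.mat *
      controlled (Sum.inr c) (Sum.inl c.1) (P c.1)) *ᵥ χ) χ₀
  (suppList P).foldl (fun χ c =>
    (onQubit (Sum.inr c) (f.had c).mat * onQubit (Sum.inr c) hadamard) *ᵥ χ) χ₁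

/-- The (unnormalised) state of the data if the measurements of the ancillas in the `Z` basis
project onto the basis state `b`. Its norm squared is the probability of `b` (for a normalised
input). -/
noncomputable def afterMeasurement {n : ℕ} (P : PauliString (Fin n)) (f : Faults P)
    (b : Supp P → Fin 2) (φ : State (Fin n)) : State (Fin n) :=
  fun a => beforeMeasurement P f φ (Sum.elim a b)

/-- The parity of the recorded measurement results. -/
def recordedParity {n : ℕ} {P : PauliString (Fin n)} (f : Faults P) (b : Supp P → Fin 2) :
    ZMod 2 :=
  ∑ c, (((b c).val : ZMod 2) + f.flip c)

namespace StabilizerCode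

variable {n r : ℕ} (C : StabilizerCode n r)

/-- The faults in one round of full syndrome measurements. -/
abbrev RoundFaults : Type := ∀ i : Fin r, Faults (C.pauli i)

/-- The projective results on the ancillas in one round of full syndrome measurements. -/
abbrev RoundResults : Type := ∀ i : Fin r, Supp (C.pauli i) → Fin 2

/-- One round: the generators are measured one after the other with fresh ancillas. -/
noncomputable def round (F : C.RoundFaults) (b : C.RoundResults) (φ : State (Fin n)) :
    State (Fin n) :=
  (List.finRange r).foldl (fun χ i => afterMeasurement (C.pauli i) (F i) (b i) χ) φ

/-- The syndrome obtained from one round. The circuit measures the Pauli string of a generator, so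
for a generator with the sign `-` the bit is inverted. -/
def roundSyndrome (F : C.RoundFaults) (b : C.RoundResults) : C.Syndrome :=
  fun i => recordedParity (F i) (b i) + C.sign i

/-- The state of the data after the first `m` rounds. -/
noncomputable def afterRounds (F : ℕ → C.RoundFaults) (b : ℕ → C.RoundResults)
    (φ : State (Fin n)) : ℕ → State (Fin n)
  | 0 => φ
  | m + 1 => C.round (F m) (b m) (afterRounds F b φ m)

end StabilizerCode

/-! ### Difference vectors and the search for usable zero substrings -/

/-- The difference vector of `m` rounds with the syndromes `s 0, …, s (m - 1)` (rounds are counted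
from `0`): `m - 1` bits, the `i`-th bit telling whether `s i ≠ s (i + 1)`. -/
def diffVec {S : Type} [DecidableEq S] (s : ℕ → S) (m : ℕ) : List Bool :=
  (List.range (m - 1)).map fun i => decide (s (i + 1) ≠ s i)

/-- The number of non-overlapping substrings `11`. -/
def pairs11 : List Bool → ℕ
  | true :: true :: l => 1 + pairs11 l
  | _ :: l => pairs11 l
  | [] => 0

/-- The number of ones that remain once the non-overlapping substrings `11` are removed. -/
def remainingOnes : List Bool → ℕ
  | true :: true :: l => remainingOnes l
  | true :: l => 1 + remainingOnes l
  | false :: l => remainingOnes l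
  | [] => 0

/-- The minimum number of faults leading to a string, as it is estimated by the protocol. -/
def minFaults (l : List Bool) : ℕ := pairs11 l + remainingOnes l

/-- The search returns, for the fault number `t` and the difference vector `δ = A η B`, the maximal
zero substring `η` of length `γ > 0`. So `A` is empty or ends with `1`, `B` is empty or starts with
`1`, and `α + β + γ ≥ t` where `α`, `β` are the numbers of faults leading to the strings before and
after `1η1` (`0` if `A`, respectively `B`, is empty). -/
def Returns (t : ℕ) (δ A : List Bool) (γ : ℕ) (B : List Bool) : Prop :=
  δ = A ++ List.replicate γ false ++ B ∧ 0 < γ ∧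
  (A = [] ∨ A.getLast? = some true) ∧ (B = [] ∨ B.head? = some true) ∧
  t ≤ minFaults A.dropLast + minFaults B.tail + γ

/-- A usable zero substring is found in `δ`. -/
def FindsUsable (t : ℕ) (δ : List Bool) : Prop := ∃ A γ B, Returns t δ A γ B

/-- With the current difference vector `δ`, the protocol may stop and use the syndrome of round `k`
(rounds are counted from `0`): either `k` is a round corresponding to a zero of a usable zero
substring (the bit `i` corresponds to the rounds `i` and `i + 1`), or there are `t` non-overlapping
substrings `11` and `k` is the latest round. -/
def StopsWith (t : ℕ) (δ : List Bool) (k : ℕ) : Prop :=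
  (∃ A γ B, Returns t δ A γ B ∧ A.length ≤ k ∧ k ≤ A.length + γ) ∨
  (pairs11 δ = t ∧ k = δ.length)

/-- One of the two conditions to stop the syndrome measurements is satisfied. -/
def Stops (t : ℕ) (δ : List Bool) : Prop := FindsUsable t δ ∨ pairs11 δ = t

/-! ### The adaptive strong protocol -/

/-- The adaptive strong protocol for `t` faults, performing at most `N` rounds of full syndrome
measurements. Syndrome measurements go on until a condition to stop is satisfied for the first time,
say after `m` rounds; then a minimum weight correction `R` for the syndrome of a round `k` as above
is applied. `G` is the Pauli error due to faults of the one-qubit gates of this last step. The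
number of faults is counted over the rounds that are performed and the last step, and the output has
nonzero probability. Where the protocol leaves a choice (`k`, `R`), every choice is allowed. -/
def StabilizerCode.adaptiveStrong {n r : ℕ} (C : StabilizerCode n r) (t N : ℕ)
    (faults : ℕ) (φ φ' : State (Fin n)) : Prop :=
  ∃ (F : ℕ → C.RoundFaults) (b : ℕ → C.RoundResults) (m k : ℕ) (R G : PauliString (Fin n)),
    let s : ℕ → C.Syndrome := fun j => C.roundSyndrome (F j) (b j)
    1 ≤ m ∧ m ≤ N ∧
    (∀ m', 1 ≤ m' → m' < m → ¬ Stops t (diffVec s m')) ∧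
    StopsWith t (diffVec s m) k ∧
    C.IsCorrection (s k) R ∧
    φ' = G.op *ᵥ (R.op *ᵥ C.afterRounds F b φ m) ∧ φ' ≠ 0 ∧
    faults = (∑ j ∈ Finset.range m, ∑ i, (F j i).count) + G.wt

/-- The number of rounds: `((t+3)/2)² - 1` for odd `t`, `((t+2)/2)((t+4)/2) - 1` for even `t`
(the divisions are exact). -/
def numRounds (t : ℕ) : ℕ :=
  if Odd t then ((t + 3) / 2) ^ 2 - 1 else ((t + 2) / 2) * ((t + 4) / 2) - 1

end AdaptiveShor

/-! Fault tolerance reduces to a counting statement about rounds. In the faulty Shor circuit every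
gate touches a single pair (data qubit, its ancilla), so on each of the two branches of the cat
state the circuit is a product of one-pair maps. A calculation with 2×2 matrices for one pair gives
`exists_afterMeasurement_eq`: the data undergo `E (1 ± P)` up to a scalar, where the weight of `E`
is at most the number of faults and the sign is the recorded one if there are none. Hence a round
without faults puts the data into the eigenspace of its recorded syndrome (`inSyndrome_round`), and
from an eigenspace on, all further rounds amount to one Pauli error of weight at most the number of
faults (`InSyndrome.exists_afterRounds_eq`).

It therefore suffices that the syndrome used is that of some fault-free round
(`exists_clean_round`). A one in the difference vector needs a fault in one of its two rounds, and
two ones share a round only if they are adjacent, so a string forces at least `minFaults` faults.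
For a usable `η`, the strings before and after `1η1` force `α + β` faults in rounds disjoint from
the `γ + 1` rounds of `η`; if these were all faulty there would be at least `α + β + γ + 1 > t`
faults. With `t` pairs `11`, all `t` faults are forced before the latest round. The correction can
then be moved back to just after the clean round, which gives ECCP and ECRP.

For the length bound, let `M = minFaults δ` and `d = t - M`. The estimate `α + β` for a zero run
differs from `M` only because the two neighbouring runs of ones, of lengths `m` and `m'`, count with
their halves rounded down instead of up. So an unusable run has `γ + 1 ≤ d + m % 2 + m' % 2`.
Summing over the `p ≤ M + 1` zero runs gives `|δ| + 1 ≤ p d + 2 M`, whence `|δ| + 3 ≤ (M + 1)(d +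
2)`. The two factors add up to `t + 3`, and the balanced choice gives `N(t) + 1`. Equality is
attained by `M = k` isolated ones, with end runs of `a` zeros and inner runs of `a + 1` zeros, for
`a = ⌊t/2⌋` and `k = t - a`. -/

namespace AdaptiveShor

/-! ### Signs -/

/-- The sign `(-1)^a` of a bit. -/
noncomputable def sgn (a : ZMod 2) : ℂ := (-1 : ℂ) ^ a.val

@[simp] lemma sgn_zero : sgn 0 = 1 := by simp [sgn]

@[simp] lemma sgn_one : sgn 1 = -1 := by
  have : (1 : ZMod 2).val = 1 := rfl
  simp [sgn, this]

lemma zmod_two_cases (a : ZMod 2) : a = 0 ∨ a = 1 := by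
  revert a; decide

lemma sgn_add (a b : ZMod 2) : sgn (a + b) = sgn a * sgn b := by
  have h : (1 + 1 : ZMod 2) = 0 := rfl
  rcases zmod_two_cases a with rfl | rfl <;> rcases zmod_two_cases b with rfl | rfl <;> simp [h]

lemma sgn_mul_self (a : ZMod 2) : sgn a * sgn a = 1 := by
  rcases zmod_two_cases a with rfl | rfl <;> simp

lemma sgn_injective : Function.Injective sgn := by
  intro a b h
  rcases zmod_two_cases a with rfl | rfl <;> rcases zmod_two_cases b with rfl | rfl <;>
    simp_all <;> norm_num at h

lemma sgn_sum {ι : Type*} (s : Finset ι) (f : ι → ZMod 2) :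
    sgn (∑ i ∈ s, f i) = ∏ i ∈ s, sgn (f i) := by
  classical
  induction s using Finset.induction_on with
  | empty => simp
  | insert a s ha ih => rw [Finset.sum_insert ha, Finset.prod_insert ha, sgn_add, ih]

/-! ### Tensor products of single-qubit operators -/

section Tensor

variable {Q : Type} [Fintype Q]

lemma tensor_mul [DecidableEq Q] (A B : Q → Matrix (Fin 2) (Fin 2) ℂ) :
    tensor A * tensor B = tensor (fun q => A q * B q) := by
  ext a b
  simp only [tensor, Matrix.mul_apply, Matrix.of_apply]
  rw [Finset.prod_univ_sum, Fintype.piFinset_univ]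
  simp [Finset.prod_mul_distrib]

lemma tensor_one [DecidableEq Q] : tensor (fun _ : Q => 1) = 1 := by
  ext a b
  simp only [tensor, Matrix.of_apply, Matrix.one_apply]
  by_cases h : a = b
  · simp [h]
  · obtain ⟨q, hq⟩ := Function.ne_iff.1 h
    rw [if_neg h]
    exact Finset.prod_eq_zero (Finset.mem_univ q) (by simp [hq])

lemma tensor_smul (c : Q → ℂ) (A : Q → Matrix (Fin 2) (Fin 2) ℂ) :
    tensor (fun q => c q • A q) = (∏ q, c q) • tensor A := by
  ext a b
  simp [tensor, Finset.prod_mul_distrib]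

lemma tensor_update_apply [DecidableEq Q] (A : Q → Matrix (Fin 2) (Fin 2) ℂ) (q : Q)
    (M : Matrix (Fin 2) (Fin 2) ℂ) (a b : Q → Fin 2) :
    tensor (Function.update A q M) a b =
      M (a q) (b q) * ∏ p ∈ Finset.univ.erase q, A p (a p) (b p) := by
  simp only [tensor, Matrix.of_apply]
  rw [← Finset.mul_prod_erase Finset.univ _ (Finset.mem_univ q)]
  simp only [Function.update_self]
  congr 1
  refine Finset.prod_congr rfl fun p hp => ?_
  rw [Function.update_of_ne (Finset.ne_of_mem_erase hp)]

lemma tensor_update_sum [DecidableEq Q] (A : Q → Matrix (Fin 2) (Fin 2) ℂ) (q : Q)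
    {ι : Type*} (s : Finset ι) (c : ι → ℂ) (M : ι → Matrix (Fin 2) (Fin 2) ℂ) :
    tensor (Function.update A q (∑ i ∈ s, c i • M i)) =
      ∑ i ∈ s, c i • tensor (Function.update A q (M i)) := by
  ext a b
  rw [tensor_update_apply, Matrix.sum_apply, Matrix.sum_apply, Finset.sum_mul]
  refine Finset.sum_congr rfl fun i _ => ?_
  rw [Matrix.smul_apply, Matrix.smul_apply, tensor_update_apply, smul_eq_mul, smul_eq_mul,
    mul_assoc]

lemma tensor_update_add [DecidableEq Q] (A : Q → Matrix (Fin 2) (Fin 2) ℂ) (q : Q)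
    (M N : Matrix (Fin 2) (Fin 2) ℂ) :
    tensor (Function.update A q (M + N)) =
      tensor (Function.update A q M) + tensor (Function.update A q N) := by
  ext a b
  rw [Matrix.add_apply, tensor_update_apply, tensor_update_apply, tensor_update_apply,
    Matrix.add_apply, add_mul]

lemma onQubit_mul_tensor [DecidableEq Q] (q : Q) (M : Matrix (Fin 2) (Fin 2) ℂ)
    (A : Q → Matrix (Fin 2) (Fin 2) ℂ) :
    onQubit q M * tensor A = tensor (Function.update A q (M * A q)) := by
  rw [onQubit, tensor_mul]
  congr 1
  funext p
  by_cases h : p = q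
  · subst h; simp
  · simp [h]

lemma onQubit_mulVec_apply [DecidableEq Q] (q : Q) (M : Matrix (Fin 2) (Fin 2) ℂ)
    (χ : State Q) (a : Q → Fin 2) :
    (onQubit q M *ᵥ χ) a = ∑ y, M (a q) y * χ (Function.update a q y) := by
  simp only [Matrix.mulVec, dotProduct, onQubit, tensor_update_apply]
  have key : ∀ b : Q → Fin 2, (∏ p ∈ Finset.univ.erase q, (1 : Matrix (Fin 2) (Fin 2) ℂ) (a p) (b p))
      = ∑ y, if b = Function.update a q y then (1 : ℂ) else 0 := by
    intro b
    by_cases h : ∀ p, p ≠ q → a p = b p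
    · have hb : b = Function.update a q (b q) := by
        funext p
        by_cases hp : p = q
        · subst hp; simp
        · simp [hp, h p hp]
      rw [Finset.sum_eq_single (b q), if_pos hb]
      · exact Finset.prod_eq_one fun p hp => by
          rw [h p (Finset.ne_of_mem_erase hp)]; exact Matrix.one_apply_eq _
      · intro y _ hy
        refine if_neg fun hby => hy ?_
        rw [hby]; simp
      · simp
    · push Not at h
      obtain ⟨p, hp, hab⟩ := h
      refine (Finset.prod_eq_zero (i := p) (Finset.mem_erase.2 ⟨hp, Finset.mem_univ p⟩)
        (by exact Matrix.one_apply_ne hab)).trans ?_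
      refine (Finset.sum_eq_zero fun y _ => if_neg fun hby => hab ?_).symm
      rw [hby]; simp [hp]
  simp only [key, Finset.mul_sum, Finset.sum_mul]
  rw [Finset.sum_comm]
  refine Finset.sum_congr rfl fun y _ => ?_
  rw [Finset.sum_eq_single (Function.update a q y)]
  · simp
  · intro b _ hb
    simp [hb]
  · simp

end Tensor

/-! ### Pauli strings -/

lemma Pauli.mat_mul_self (p : Pauli) : p.mat * p.mat = 1 := by
  cases p <;> ext i j <;> fin_cases i <;> fin_cases j <;> simp [Pauli.mat, Matrix.mul_apply]

/-- The product of Pauli letters, without phase. -/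
def Pauli.prod : Pauli → Pauli → Pauli
  | .I, q => q
  | p, .I => p
  | .X, .X => .I
  | .X, .Y => .Z
  | .X, .Z => .Y
  | .Y, .X => .Z
  | .Y, .Y => .I
  | .Y, .Z => .X
  | .Z, .X => .Y
  | .Z, .Y => .X
  | .Z, .Z => .I

lemma Pauli.exists_mat_mul (p q : Pauli) :
    ∃ c : ℂ, c ≠ 0 ∧ p.mat * q.mat = c • (p.prod q).mat := by
  have hI := Complex.I_ne_zero
  cases p <;> cases q <;>
    first
    | (refine ⟨1, one_ne_zero, ?_⟩
       ext i j; fin_cases i <;> fin_cases j <;>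
        simp [Pauli.mat, Matrix.mul_apply, Pauli.prod]; done)
    | (refine ⟨Complex.I, hI, ?_⟩
       ext i j; fin_cases i <;> fin_cases j <;>
        simp [Pauli.mat, Matrix.mul_apply, Pauli.prod]; done)
    | (refine ⟨-Complex.I, neg_ne_zero.2 hI, ?_⟩
       ext i j; fin_cases i <;> fin_cases j <;>
        simp [Pauli.mat, Matrix.mul_apply, Pauli.prod])

lemma Pauli.exists_mat_mul_comm (p q : Pauli) :
    ∃ a : ZMod 2, p.mat * q.mat = sgn a • (q.mat * p.mat) := by
  cases p <;> cases q <;>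
    first
    | (refine ⟨0, ?_⟩
       ext i j; fin_cases i <;> fin_cases j <;> simp [Pauli.mat, Matrix.mul_apply]; done)
    | (refine ⟨1, ?_⟩
       ext i j; fin_cases i <;> fin_cases j <;> simp [Pauli.mat, Matrix.mul_apply])

namespace PauliString

variable {Q : Type} [Fintype Q] [DecidableEq Q]

lemma op_mul_self (P : PauliString Q) : P.op * P.op = 1 := by
  simp only [op, tensor_mul, Pauli.mat_mul_self, tensor_one]

lemma exists_op_mul_comm (P R : PauliString Q) :
    ∃ a : ZMod 2, P.op * R.op = sgn a • (R.op * P.op) := by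
  choose a ha using fun q => Pauli.exists_mat_mul_comm (P q) (R q)
  refine ⟨∑ q, a q, ?_⟩
  simp only [op, tensor_mul]
  rw [sgn_sum, ← tensor_smul]
  simp only [ha]

/-- The product of Pauli strings, without phase. -/
def prod (P R : PauliString Q) : PauliString Q := fun q => (P q).prod (R q)

lemma exists_op_mul (P R : PauliString Q) :
    ∃ c : ℂ, c ≠ 0 ∧ P.op * R.op = c • (P.prod R).op := by
  choose c hc using fun q => Pauli.exists_mat_mul (P q) (R q)
  refine ⟨∏ q, c q, Finset.prod_ne_zero_iff.2 fun q _ => (hc q).1, ?_⟩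
  simp only [op, tensor_mul]
  rw [← tensor_smul]
  simp only [(hc _).2]
  rfl

lemma wt_prod_le (P R : PauliString Q) : (P.prod R).wt ≤ P.wt + R.wt := by
  refine le_trans (Finset.card_le_card ?_) (Finset.card_union_le _ _)
  intro q
  simp only [Finset.mem_filter, Finset.mem_univ, true_and, Finset.mem_union]
  contrapose!
  rintro ⟨h₁, h₂⟩
  simp [prod, h₁, h₂, Pauli.prod]

lemma op_of_wt_eq_zero {P : PauliString Q} (h : P.wt = 0) : P.op = 1 := by
  have h' : ∀ q, P q = Pauli.I := by
    simpa [wt, Finset.filter_eq_empty_iff] using h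
  simp only [op, h', Pauli.mat, tensor_one]

lemma op_mulVec_op_mulVec (P : PauliString Q) (χ : State Q) : P.op *ᵥ (P.op *ᵥ χ) = χ := by
  rw [Matrix.mulVec_mulVec, op_mul_self, Matrix.one_mulVec]

lemma op_mulVec_ne_zero {χ : State Q} (hχ : χ ≠ 0) (P : PauliString Q) : P.op *ᵥ χ ≠ 0 := by
  intro h
  have := P.op_mulVec_op_mulVec χ
  rw [h, Matrix.mulVec_zero] at this
  exact hχ this.symm

end PauliString

/-! ### Product states of the Shor circuit -/

section Circuit

variable {n : ℕ} {P : PauliString (Fin n)}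

/-- The operators on the data qubits selected by the ancilla basis state `a`. -/
noncomputable def spread (W : Supp P → Fin 2 → Matrix (Fin 2) (Fin 2) ℂ) (a : Supp P → Fin 2) :
    Fin n → Matrix (Fin 2) (Fin 2) ℂ :=
  fun q => if h : P q ≠ Pauli.I then W ⟨q, h⟩ (a ⟨q, h⟩) else 1

/-- The state of data and ancillas obtained from `φ` by a product operator, where `W c y` acts on
the data qubit of `c` if the ancilla qubit `c` is in the basis state `y`. -/
noncomputable def prodState (φ : State (Fin n)) (W : Supp P → Fin 2 → Matrix (Fin 2) (Fin 2) ℂ) :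
    State (Fin n ⊕ Supp P) :=
  fun a => (tensor (spread W fun c => a (Sum.inr c)) *ᵥ φ) fun q => a (Sum.inl q)

lemma spread_apply_supp (W : Supp P → Fin 2 → Matrix (Fin 2) (Fin 2) ℂ) (a : Supp P → Fin 2)
    (c : Supp P) : spread W a c.1 = W c (a c) := by
  obtain ⟨q, h⟩ := c
  exact dif_pos h

lemma spread_update_left (W : Supp P → Fin 2 → Matrix (Fin 2) (Fin 2) ℂ) (a : Supp P → Fin 2)
    (c : Supp P) (u : Fin 2 → Matrix (Fin 2) (Fin 2) ℂ) :
    spread (Function.update W c u) a = Function.update (spread W a) c.1 (u (a c)) := by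
  funext q
  by_cases hq : q = c.1
  · subst hq
    rw [spread_apply_supp]; simp
  · rw [Function.update_of_ne hq]
    unfold spread
    split_ifs with h
    · rw [Function.update_of_ne]
      rintro rfl
      exact hq rfl
    · rfl

lemma spread_update_right (W : Supp P → Fin 2 → Matrix (Fin 2) (Fin 2) ℂ) (a : Supp P → Fin 2)
    (c : Supp P) (y : Fin 2) :
    spread W (Function.update a c y) = Function.update (spread W a) c.1 (W c y) := by
  funext q
  by_cases hq : q = c.1
  · subst hq
    rw [spread_apply_supp]; simp
  · rw [Function.update_of_ne hq]
    unfold spread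
    split_ifs with h
    · rw [Function.update_of_ne]
      rintro rfl
      exact hq rfl
    · rfl

lemma update_inl_comp_inr (a : Fin n ⊕ Supp P → Fin 2) (q : Fin n) (y : Fin 2) :
    (fun c => Function.update a (Sum.inl q) y (Sum.inr c)) = fun c : Supp P => a (Sum.inr c) := by
  funext c; simp

lemma update_inl_comp_inl (a : Fin n ⊕ Supp P → Fin 2) (q : Fin n) (y : Fin 2) :
    (fun p => Function.update a (Sum.inl q) y (Sum.inl p)) =
      Function.update (fun p => a (Sum.inl p)) q y := by
  funext p
  by_cases h : p = q
  · subst h; simp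
  · simp [h]

lemma update_inr_comp_inl (a : Fin n ⊕ Supp P → Fin 2) (c : Supp P) (y : Fin 2) :
    (fun q => Function.update a (Sum.inr c) y (Sum.inl q)) = fun q => a (Sum.inl q) := by
  funext c; simp

lemma update_inr_comp_inr (a : Fin n ⊕ Supp P → Fin 2) (c : Supp P) (y : Fin 2) :
    (fun p => Function.update a (Sum.inr c) y (Sum.inr p)) =
      Function.update (fun p => a (Sum.inr p)) c y := by
  funext p
  by_cases h : p = c
  · subst h; simp
  · simp [h]

lemma onQubit_inl_prodState (c : Supp P) (M : Matrix (Fin 2) (Fin 2) ℂ) (φ : State (Fin n))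
    (W : Supp P → Fin 2 → Matrix (Fin 2) (Fin 2) ℂ) :
    onQubit (Sum.inl c.1) M *ᵥ prodState φ W =
      prodState φ (Function.update W c fun y => M * W c y) := by
  funext a
  rw [onQubit_mulVec_apply]
  simp only [prodState, update_inl_comp_inr, update_inl_comp_inl, spread_update_left]
  rw [← spread_apply_supp W (fun c => a (Sum.inr c)) c, ← onQubit_mul_tensor,
    ← Matrix.mulVec_mulVec, onQubit_mulVec_apply]

lemma onQubit_inr_prodState (c : Supp P) (B : Matrix (Fin 2) (Fin 2) ℂ) (φ : State (Fin n))
    (W : Supp P → Fin 2 → Matrix (Fin 2) (Fin 2) ℂ) :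
    onQubit (Sum.inr c) B *ᵥ prodState φ W =
      prodState φ (Function.update W c fun y => ∑ z, B y z • W c z) := by
  funext a
  rw [onQubit_mulVec_apply]
  simp only [prodState, update_inr_comp_inr, update_inr_comp_inl, spread_update_left,
    spread_update_right]
  rw [tensor_update_sum, Matrix.sum_mulVec, Finset.sum_apply]
  refine Finset.sum_congr rfl fun y _ => ?_
  rw [Matrix.smul_mulVec, Pi.smul_apply, smul_eq_mul]

lemma prodState_update_add (φ : State (Fin n)) (W : Supp P → Fin 2 → Matrix (Fin 2) (Fin 2) ℂ)
    (c : Supp P) (u v : Fin 2 → Matrix (Fin 2) (Fin 2) ℂ) :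
    prodState φ (Function.update W c u) + prodState φ (Function.update W c v) =
      prodState φ (Function.update W c (u + v)) := by
  funext a
  simp only [prodState, Pi.add_apply, spread_update_left, tensor_update_add, Matrix.add_mulVec]

lemma controlled_prodState (c : Supp P) (R : Pauli) (φ : State (Fin n))
    (W : Supp P → Fin 2 → Matrix (Fin 2) (Fin 2) ℂ) :
    controlled (Sum.inr c) (Sum.inl c.1) R *ᵥ prodState φ W =
      prodState φ (Function.update W c fun y => if y = 0 then W c 0 else R.mat * W c 1) := by
  rw [controlled, Matrix.add_mulVec, ← Matrix.mulVec_mulVec, onQubit_inl_prodState,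
    onQubit_inr_prodState, onQubit_inr_prodState, Function.update_idem, prodState_update_add]
  congr 2
  funext y
  fin_cases y <;> simp

/-- The effect of a faulty controlled gate on the operators belonging to an ancilla qubit. -/
noncomputable def ctrlStep (R : Pauli) (g : Pauli × Pauli)
    (w : Fin 2 → Matrix (Fin 2) (Fin 2) ℂ) : Fin 2 → Matrix (Fin 2) (Fin 2) ℂ :=
  fun y => g.1.mat * ∑ z, g.2.mat y z • (if z = 0 then w 0 else R.mat * w 1)

/-- The effect of a faulty Hadamard gate on the operators belonging to an ancilla qubit. -/
noncomputable def hadStep (g : Pauli) (w : Fin 2 → Matrix (Fin 2) (Fin 2) ℂ) :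
    Fin 2 → Matrix (Fin 2) (Fin 2) ℂ :=
  fun y => ∑ z, g.mat y z • ∑ z', hadamard z z' • w z'

lemma ctrlStep_prodState (c : Supp P) (R : Pauli) (g : Pauli × Pauli) (φ : State (Fin n))
    (W : Supp P → Fin 2 → Matrix (Fin 2) (Fin 2) ℂ) :
    (onQubit (Sum.inl c.1) g.1.mat * onQubit (Sum.inr c) g.2.mat *
      controlled (Sum.inr c) (Sum.inl c.1) R) *ᵥ prodState φ W =
      prodState φ (Function.update W c (ctrlStep R g (W c))) := by
  rw [← Matrix.mulVec_mulVec, ← Matrix.mulVec_mulVec, controlled_prodState,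
    onQubit_inr_prodState, onQubit_inl_prodState]
  simp only [Function.update_idem, Function.update_self]
  rfl

lemma hadStep_prodState (c : Supp P) (g : Pauli) (φ : State (Fin n))
    (W : Supp P → Fin 2 → Matrix (Fin 2) (Fin 2) ℂ) :
    (onQubit (Sum.inr c) g.mat * onQubit (Sum.inr c) hadamard) *ᵥ prodState φ W =
      prodState φ (Function.update W c (hadStep g (W c))) := by
  rw [← Matrix.mulVec_mulVec, onQubit_inr_prodState, onQubit_inr_prodState]
  simp only [Function.update_idem, Function.update_self]
  rfl

/-- Each step alters only the factor of its own ancilla and every ancilla occurs once, so the steps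
act independently. This reduces the circuit to a single pair of qubits. -/
lemma foldl_prodState (φ : State (Fin n)) (M : Supp P → Oper (Fin n ⊕ Supp P))
    (g : Supp P → (Fin 2 → Matrix (Fin 2) (Fin 2) ℂ) → Fin 2 → Matrix (Fin 2) (Fin 2) ℂ)
    (hM : ∀ c W, M c *ᵥ prodState φ W = prodState φ (Function.update W c (g c (W c))))
    (l : List (Supp P)) (hl : l.Nodup) (W : Supp P → Fin 2 → Matrix (Fin 2) (Fin 2) ℂ) :
    l.foldl (fun χ c => M c *ᵥ χ) (prodState φ W) =
      prodState φ fun c => if c ∈ l then g c (W c) else W c := by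
  induction l generalizing W with
  | nil => simp
  | cons c l ih =>
    rw [List.nodup_cons] at hl
    rw [List.foldl_cons, hM, ih hl.2]
    congr 1
    funext d
    by_cases hd : d = c
    · subst hd; simp [hl.1]
    · simp [hd]

lemma foldl_mulVec_sum_smul {Q ι κ : Type} [Fintype Q] [DecidableEq Q] (M : ι → Oper Q) (l : List ι)
    (s : Finset κ) (z : κ → ℂ) (χ : κ → State Q) :
    l.foldl (fun χ c => M c *ᵥ χ) (∑ x ∈ s, z x • χ x) =
      ∑ x ∈ s, z x • l.foldl (fun χ c => M c *ᵥ χ) (χ x) := by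
  induction l generalizing χ with
  | nil => rfl
  | cons c l ih =>
    simp only [List.foldl_cons]
    rw [← ih, Matrix.mulVec_sum]
    simp only [Matrix.mulVec_smul]

lemma mem_suppList (c : Supp P) : c ∈ suppList P := by
  obtain ⟨q, h⟩ := c
  simp only [suppList, List.mem_filterMap, List.mem_finRange, true_and]
  exact ⟨q, by rw [dif_pos h]⟩

lemma nodup_suppList : (suppList P).Nodup := by
  refine (List.nodup_finRange n).filterMap fun q q' c hc hc' => ?_
  simp only [Option.mem_def] at hc hc'
  split_ifs at hc hc'
  simp only [Option.some.injEq] at hc hc'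
  have := hc.trans hc'.symm
  simpa using this

/-- The cat state is entangled, but each of its branches `x = 0, 1` is a product state, on which the
preparation error acts factor by factor. -/
lemma joint_prep_cat (f : PauliString (Supp P)) (φ : State (Fin n)) :
    joint φ (f.op *ᵥ cat (Supp P)) =
      ∑ x : Fin 2, ((1 / Real.sqrt 2 : ℝ) : ℂ) • prodState φ fun c y => (f c).mat y x • 1 := by
  funext a
  have h1 : ∀ x : Fin 2, tensor (spread (P := P) (fun c y => (f c).mat y x • 1)
      fun c => a (Sum.inr c)) = (∏ c, (f c).mat (a (Sum.inr c)) x) • (1 : Oper (Fin n)) := by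
    intro x
    have : spread (P := P) (fun c y => (f c).mat y x • 1) (fun c => a (Sum.inr c)) =
        fun q => (if h : P q ≠ Pauli.I then (f ⟨q, h⟩).mat (a (Sum.inr ⟨q, h⟩)) x else 1) •
          (1 : Matrix (Fin 2) (Fin 2) ℂ) := by
      funext q
      unfold spread
      split_ifs <;> simp
    rw [this, tensor_smul, tensor_one, Fintype.prod_dite]
    simp
  simp only [Finset.sum_apply, Pi.smul_apply, prodState, h1, Matrix.smul_mulVec,
    Matrix.one_mulVec, smul_eq_mul, joint]
  have h2 : ∀ x : Fin 2, (∑ b : Supp P → Fin 2, f.op (fun c => a (Sum.inr c)) b *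
      (if ∀ c, b c = x then 1 else 0)) = ∏ c, (f c).mat (a (Sum.inr c)) x := by
    intro x
    rw [Finset.sum_eq_single fun _ => x]
    · simp [PauliString.op, tensor]
    · intro b _ hb
      rw [if_neg, mul_zero]
      exact fun h => hb (funext h)
    · simp
  have h3 : (f.op *ᵥ cat (Supp P)) (fun c => a (Sum.inr c)) =
      ∑ x : Fin 2, ((1 / Real.sqrt 2 : ℝ) : ℂ) * ∏ c, (f c).mat (a (Sum.inr c)) x := by
    simp only [← h2, Fin.sum_univ_two, Matrix.mulVec, dotProduct, cat]
    rw [Finset.mul_sum, Finset.mul_sum, ← Finset.sum_add_distrib]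
    refine Finset.sum_congr rfl fun b _ => ?_
    ring
  rw [h3, Finset.mul_sum]
  refine Finset.sum_congr rfl fun x _ => ?_
  ring

lemma beforeMeasurement_eq (f : Faults P) (φ : State (Fin n)) :
    beforeMeasurement P f φ = ∑ x : Fin 2, ((1 / Real.sqrt 2 : ℝ) : ℂ) • prodState φ fun c =>
      hadStep (f.had c) (ctrlStep (P c.1) (f.ctrl c) fun y => (f.prep c).mat y x • 1) := by
  unfold beforeMeasurement
  simp only
  rw [joint_prep_cat, foldl_mulVec_sum_smul]
  simp only [foldl_prodState φ _ (fun c => ctrlStep (P c.1) (f.ctrl c))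
    (fun c W => ctrlStep_prodState c (P c.1) (f.ctrl c) φ W) _ nodup_suppList, mem_suppList, if_true]
  rw [foldl_mulVec_sum_smul]
  simp only [foldl_prodState φ _ (fun c => hadStep (f.had c))
    (fun c W => hadStep_prodState c (f.had c) φ W) _ nodup_suppList, mem_suppList, if_true]

end Circuit

/-! ### The effect of a Shor circuit on the data qubits -/

/-- Conjugation of a Pauli letter by the Hadamard gate, without phase. -/
def Pauli.swap : Pauli → Pauli
  | .I => .I
  | .X => .Z
  | .Y => .Y
  | .Z => .X

lemma Pauli.exists_hadamard_mul (p : Pauli) :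
    ∃ c : ℂ, hadamard * p.mat = c • (p.swap.mat * hadamard) := by
  cases p
  · exact ⟨1, by simp [Pauli.mat, Pauli.swap]⟩
  · refine ⟨1, ?_⟩
    ext i j; fin_cases i <;> fin_cases j <;>
      simp [Pauli.mat, Matrix.mul_apply, Pauli.swap, hadamard]
  · refine ⟨-1, ?_⟩
    ext i j; fin_cases i <;> fin_cases j <;>
      simp [Pauli.mat, Matrix.mul_apply, Pauli.swap, hadamard, mul_comm]
  · refine ⟨1, ?_⟩
    ext i j; fin_cases i <;> fin_cases j <;>
      simp [Pauli.mat, Matrix.mul_apply, Pauli.swap, hadamard]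

/-- The `X` part of `q` shifts the output `y` by `ε`, and its `Z` part only contributes a phase
depending on `y`. It is essential that `κ` does not depend on the branch `x`: otherwise the two
branches would not recombine to `1 ± P`. -/
lemma Pauli.exists_mat_mul_hadamard (q : Pauli) :
    ∃ (ε : ZMod 2) (κ : Fin 2 → ℂ), (q = .I → ε = 0) ∧
      ∀ x y : Fin 2, (q.mat * hadamard) y x =
        κ y * sgn ((x.val : ZMod 2) * ((y.val : ZMod 2) + ε)) := by
  have h11 : (1 + 1 : ZMod 2) = 0 := rfl
  set s : ℂ := ((1 / Real.sqrt 2 : ℝ) : ℂ) with hs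
  cases q
  · refine ⟨0, fun _ => s, fun _ => rfl, ?_⟩
    intro x y; fin_cases x <;> fin_cases y <;> simp [Pauli.mat, hadamard, hs]
  · refine ⟨1, fun _ => s, by simp, ?_⟩
    intro x y; fin_cases x <;> fin_cases y <;>
      simp [Pauli.mat, Matrix.mul_apply, hadamard, hs, h11]
  · refine ⟨1, fun y => if y = 0 then -Complex.I * s else Complex.I * s, by simp, ?_⟩
    intro x y; fin_cases x <;> fin_cases y <;>
      simp [Pauli.mat, Matrix.mul_apply, hadamard, hs, h11]
  · refine ⟨0, fun y => if y = 0 then s else -s, by simp, ?_⟩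
    intro x y; fin_cases x <;> fin_cases y <;>
      simp [Pauli.mat, Matrix.mul_apply, hadamard, hs]

lemma Pauli.exists_shift (p : Pauli) :
    ∃ ξ : Fin 2, (p = .I → ξ = 0) ∧ ∀ z x : Fin 2, z ≠ x + ξ → p.mat z x = 0 := by
  cases p
  · refine ⟨0, fun _ => rfl, fun z x => ?_⟩
    fin_cases z <;> fin_cases x <;> simp [Pauli.mat]
  · refine ⟨1, by simp, fun z x => ?_⟩
    fin_cases z <;> fin_cases x <;> simp [Pauli.mat]
  · refine ⟨1, by simp, fun z x => ?_⟩
    fin_cases z <;> fin_cases x <;> simp [Pauli.mat]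
  · refine ⟨0, by simp, fun z x => ?_⟩
    fin_cases z <;> fin_cases x <;> simp [Pauli.mat]

/-- An ancilla flip before the controlled gate complements the control bit. As `R² = 1`, this costs
one factor `R` in both branches alike, which is absorbed into the data error. -/
lemma Pauli.exists_mul_pow_shift (g R : Pauli) (ξ : Fin 2) :
    ∃ (c : ℂ) (E : Pauli), (ξ = 0 → E = g) ∧
      ∀ x : Fin 2, g.mat * R.mat ^ (x + ξ).val = c • (E.mat * R.mat ^ x.val) := by
  fin_cases ξ
  · exact ⟨1, g, fun _ => rfl, fun x => by simp⟩
  · obtain ⟨c, -, hc⟩ := Pauli.exists_mat_mul g R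
    refine ⟨c, g.prod R, by simp, fun x => ?_⟩
    have h := R.mat_mul_self
    rw [← smul_mul_assoc, ← hc]
    fin_cases x <;> simp [mul_assoc, h]

/-- On branch `x` the faulty ancilla is in the single basis state `x + ξ`, so the controlled gate
applies a definite power of `R`, and what remains is a scalar matrix entry of the ancilla operators.
-/
lemma hadStep_ctrlStep (p : Pauli) (g : Pauli × Pauli) (h R : Pauli) (x y : Fin 2) (ξ : Fin 2)
    (hξ : ∀ z x : Fin 2, z ≠ x + ξ → p.mat z x = 0) :
    hadStep h (ctrlStep R g fun y => p.mat y x • 1) y =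
      (h.mat * hadamard * (g.2.mat * p.mat)) y x • (g.1.mat * R.mat ^ (x + ξ).val) := by
  have h1 : ∀ z : Fin 2, (if z = 0 then p.mat 0 x • (1 : Matrix (Fin 2) (Fin 2) ℂ)
      else R.mat * p.mat 1 x • 1) = p.mat z x • R.mat ^ (x + ξ).val := by
    intro z
    by_cases hz : z = x + ξ
    · rw [← hz]; fin_cases z <;> simp
    · rw [hξ z x hz, zero_smul]
      fin_cases z
      · have := hξ 0 x hz
        simp only [this]; simp
      · have := hξ 1 x hz
        simp only [this]; simp
  simp only [hadStep, ctrlStep, h1]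
  simp only [smul_smul, ← Finset.sum_smul, Matrix.mul_smul]
  congr 1
  simp only [Matrix.mul_apply, Fin.sum_univ_two]
  ring

/-- All ancilla errors are pushed through the Hadamard gate and merged into one Pauli letter, which
can only flip the result. Only preparation and controlled-gate faults reach the data, so Hadamard
faults do not enter the condition for `E`. -/
lemma exists_hadStep_ctrlStep (p : Pauli) (g : Pauli × Pauli) (h R : Pauli) :
    ∃ (E : Pauli) (ε : ZMod 2) (κ : Fin 2 → ℂ), (p = .I → g = (.I, .I) → E = .I) ∧
      (p = .I → g = (.I, .I) → h = .I → ε = 0) ∧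
      ∀ x y : Fin 2, hadStep h (ctrlStep R g fun y => p.mat y x • 1) y =
        (κ y * sgn ((x.val : ZMod 2) * ((y.val : ZMod 2) + ε))) • (E.mat * R.mat ^ x.val) := by
  obtain ⟨ξ, hξ, hp⟩ := p.exists_shift
  obtain ⟨c₁, E, hE, hc₁⟩ := Pauli.exists_mul_pow_shift g.1 R ξ
  obtain ⟨c₂, -, hc₂⟩ := Pauli.exists_mat_mul g.2 p
  obtain ⟨c₃, hc₃⟩ := Pauli.exists_hadamard_mul (g.2.prod p)
  obtain ⟨c₄, -, hc₄⟩ := Pauli.exists_mat_mul h (g.2.prod p).swap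
  obtain ⟨ε, κ, hε, hκ⟩ := Pauli.exists_mat_mul_hadamard (h.prod (g.2.prod p).swap)
  refine ⟨E, ε, fun y => c₁ * c₂ * c₃ * c₄ * κ y, ?_, ?_, ?_⟩
  · rintro h1 rfl
    exact hE (hξ h1)
  · rintro rfl rfl rfl
    exact hε rfl
  · intro x y
    rw [hadStep_ctrlStep p g h R x y ξ hp, hc₁, hc₂, mul_assoc, Matrix.mul_smul, hc₃,
      Matrix.mul_smul, Matrix.mul_smul, ← mul_assoc, hc₄, Matrix.smul_mul, Matrix.smul_apply,
      Matrix.smul_apply, Matrix.smul_apply, hκ]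
    simp only [smul_eq_mul, smul_smul]
    congr 1
    ring

variable {n : ℕ} {P : PauliString (Fin n)}

lemma Faults.wt_le_count (f : Faults P) (E : PauliString (Fin n))
    (hE : ∀ q, E q ≠ .I → ∃ h : P q ≠ .I, f.prep ⟨q, h⟩ ≠ .I ∨ f.ctrl ⟨q, h⟩ ≠ (.I, .I)) :
    E.wt ≤ f.count := by
  have h1 : (Finset.univ.filter fun q => E q ≠ Pauli.I) ⊆
      ((Finset.univ.filter fun c => f.prep c ≠ Pauli.I) ∪
        (Finset.univ.filter fun c => f.ctrl c ≠ (Pauli.I, Pauli.I))).image Subtype.val := by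
    intro q hq
    obtain ⟨h, hq⟩ := hE q (Finset.mem_filter.1 hq).2
    refine Finset.mem_image.2 ⟨⟨q, h⟩, ?_, rfl⟩
    simpa using hq
  have h2 := (Finset.card_le_card h1).trans (Finset.card_image_le.trans (Finset.card_union_le _ _))
  simp only [PauliString.wt, Faults.count] at *
  omega

lemma Faults.eq_of_count_eq_zero {f : Faults P} (hf : f.count = 0) (c : Supp P) :
    f.prep c = .I ∧ f.ctrl c = (.I, .I) ∧ f.had c = .I ∧ f.flip c = 0 := by
  simp only [Faults.count, PauliString.wt, Nat.add_eq_zero_iff, Finset.card_eq_zero,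
    Finset.filter_eq_empty_iff, Finset.mem_univ, true_implies, not_not] at hf
  exact ⟨@hf.1.1.1 c, @hf.1.1.2 c, @hf.1.2 c, @hf.2 c⟩

/-- A Shor circuit projects onto an eigenspace of the measured operator, up to an error of weight at
most the number of faults; the recorded eigenvalue is correct if there are no faults. -/
lemma exists_afterMeasurement_eq (f : Faults P) (b : Supp P → Fin 2) :
    ∃ (κ : ℂ) (E : PauliString (Fin n)) (e : ZMod 2), E.wt ≤ f.count ∧ (f.count = 0 → e = 0) ∧
      ∀ φ, afterMeasurement P f b φ =
        κ • E.op *ᵥ (φ + sgn (recordedParity f b + e) • P.op *ᵥ φ) := by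
  choose E ε κ hE hε hκ using
    fun c => exists_hadStep_ctrlStep (f.prep c) (f.ctrl c) (f.had c) (P c.1)
  -- The flips are included in `e` because the recorded parity contains them: they cancel modulo 2,
  -- leaving the parity of the projective results corrected by `ε`.
  refine ⟨((1 / Real.sqrt 2 : ℝ) : ℂ) * ∏ c, κ c (b c),
    fun q => if h : P q ≠ .I then E ⟨q, h⟩ else .I, ∑ c, (ε c + f.flip c), ?_, ?_, ?_⟩
  · refine f.wt_le_count _ fun q hq => ?_
    by_cases h : P q ≠ .I
    · refine ⟨h, ?_⟩
      simp only [dif_pos h] at hq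
      by_contra! h'
      exact hq (hE _ h'.1 h'.2)
    · simp [h] at hq
  · intro hf
    refine Finset.sum_eq_zero fun c _ => ?_
    obtain ⟨h1, h2, h3, h4⟩ := Faults.eq_of_count_eq_zero hf c
    rw [hε c h1 h2 h3, h4, add_zero]
  · intro φ
    set E' : PauliString (Fin n) := fun q => if h : P q ≠ .I then E ⟨q, h⟩ else .I with hE'
    have key : ∀ x : Fin 2, tensor (spread (P := P) (fun c => hadStep (f.had c)
        (ctrlStep (P c.1) (f.ctrl c) fun y => (f.prep c).mat y x • 1)) b) =
        ((∏ c, κ c (b c)) * sgn (∑ c, (x.val : ZMod 2) * (((b c).val : ZMod 2) + ε c))) •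
          (E'.op * tensor fun q => (P q).mat ^ x.val) := by
      intro x
      have : spread (P := P) (fun c => hadStep (f.had c)
          (ctrlStep (P c.1) (f.ctrl c) fun y => (f.prep c).mat y x • 1)) b =
          fun q => (if h : P q ≠ .I then κ ⟨q, h⟩ (b ⟨q, h⟩) *
            sgn ((x.val : ZMod 2) * (((b ⟨q, h⟩).val : ZMod 2) + ε ⟨q, h⟩)) else 1) •
              ((E' q).mat * (P q).mat ^ x.val) := by
        funext q
        unfold spread
        by_cases h : P q ≠ .I
        · simp only [dif_pos h, hκ, hE']
        · have h' := not_not.1 h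
          simp [hE', h', Pauli.mat]
      rw [this, tensor_smul, Fintype.prod_dite, PauliString.op, tensor_mul, sgn_sum,
        ← Finset.prod_mul_distrib]
      simp
    have h0 : (tensor fun q => (P q).mat ^ (0 : Fin 2).val) = 1 := by
      simp only [Fin.val_zero, pow_zero]; exact tensor_one
    have h1 : (tensor fun q => (P q).mat ^ (1 : Fin 2).val) = P.op := by
      simp only [Fin.val_one, pow_one]; rfl
    have hs : recordedParity f b + ∑ c, (ε c + f.flip c) =
        ∑ c, (((b c).val : ZMod 2) + ε c) := by
      rw [recordedParity, ← Finset.sum_add_distrib]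
      refine Finset.sum_congr rfl fun c _ => ?_
      have := CharTwo.add_self_eq_zero (f.flip c)
      linear_combination this
    have hb : afterMeasurement P f b φ = ∑ x : Fin 2, ((1 / Real.sqrt 2 : ℝ) : ℂ) •
        (tensor (spread (P := P) (fun c => hadStep (f.had c)
          (ctrlStep (P c.1) (f.ctrl c) fun y => (f.prep c).mat y x • 1)) b) *ᵥ φ) := by
      funext a
      simp only [afterMeasurement, beforeMeasurement_eq, Finset.sum_apply, Pi.smul_apply, prodState,
        Sum.elim_inl, Sum.elim_inr]
    rw [hb, hs, Fin.sum_univ_two, key, key, h0, h1]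
    simp only [Fin.val_zero, Fin.val_one, Nat.cast_zero, Nat.cast_one, zero_mul, one_mul,
      Finset.sum_const_zero, sgn_zero, mul_one, Matrix.smul_mulVec, Matrix.mulVec_add,
      Matrix.mulVec_smul, smul_add, smul_smul, Matrix.mulVec_mulVec]
    congr 2
    ring

lemma PauliString.wt_identity (Q : Type) [Fintype Q] :
    PauliString.wt (fun _ : Q => Pauli.I) = 0 := by
  simp [PauliString.wt]

namespace StabilizerCode

variable {n r : ℕ} (C : StabilizerCode n r)

/-! ### Syndromes of states and of Pauli errors -/

lemma gen_eq (i : Fin r) : C.gen i = sgn (C.sign i) • (C.pauli i).op := rfl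

lemma op_pauli_eq (i : Fin r) : (C.pauli i).op = sgn (C.sign i) • C.gen i := by
  rw [gen_eq, smul_smul, sgn_mul_self, one_smul]

lemma gen_mul_self (i : Fin r) : C.gen i * C.gen i = 1 := by
  rw [gen_eq, smul_mul_smul_comm, sgn_mul_self, one_smul, PauliString.op_mul_self]

lemma gen_mul_comm (i j : Fin r) : C.gen i * C.gen j = C.gen j * C.gen i := by
  rw [gen_eq, gen_eq, smul_mul_smul_comm, smul_mul_smul_comm, (C.comm i j).eq, mul_comm (sgn _)]

/-- The state `χ` lies in the common eigenspace of the generators with the syndrome `σ`. -/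
def InSyndrome (σ : C.Syndrome) (χ : State (Fin n)) : Prop :=
  ∀ i, C.gen i *ᵥ χ = sgn (σ i) • χ

variable {C}

lemma InSyndrome.smul {σ : C.Syndrome} {χ : State (Fin n)} (h : C.InSyndrome σ χ) (c : ℂ) :
    C.InSyndrome σ (c • χ) := fun i => by
  rw [Matrix.mulVec_smul, h i, smul_comm]

lemma InSyndrome.unique {σ τ : C.Syndrome} {χ : State (Fin n)} (h : C.InSyndrome σ χ)
    (h' : C.InSyndrome τ χ) (hχ : χ ≠ 0) : σ = τ := by
  funext i
  exact sgn_injective (smul_left_injective ℂ hχ ((h i).symm.trans (h' i)))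

lemma isCodeword_iff {χ : State (Fin n)} : C.IsCodeword χ ↔ C.InSyndrome 0 χ := by
  simp [IsCodeword, InSyndrome]

lemma hasSyndrome_iff {E : PauliString (Fin n)} {σ : C.Syndrome} :
    C.HasSyndrome E σ ↔ ∀ i, C.gen i * E.op = sgn (σ i) • (E.op * C.gen i) := Iff.rfl

variable (C) in
lemma exists_hasSyndrome (E : PauliString (Fin n)) : ∃ σ, C.HasSyndrome E σ := by
  choose σ hσ using fun i => PauliString.exists_op_mul_comm (C.pauli i) E
  refine ⟨σ, hasSyndrome_iff.2 fun i => ?_⟩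
  rw [gen_eq, smul_mul_assoc, hσ, mul_smul_comm, smul_comm]

lemma HasSyndrome.inSyndrome {E : PauliString (Fin n)} {σ τ : C.Syndrome} {χ : State (Fin n)}
    (hE : C.HasSyndrome E σ) (h : C.InSyndrome τ χ) : C.InSyndrome (τ + σ) (E.op *ᵥ χ) := by
  intro i
  rw [Matrix.mulVec_mulVec, hasSyndrome_iff.1 hE i, Matrix.smul_mulVec, ← Matrix.mulVec_mulVec,
    h i, Matrix.mulVec_smul, smul_smul, Pi.add_apply, sgn_add, mul_comm]

lemma exists_inSyndrome_op {σ : C.Syndrome} {χ : State (Fin n)} (h : C.InSyndrome σ χ)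
    (E : PauliString (Fin n)) : ∃ τ, C.InSyndrome τ (E.op *ᵥ χ) := by
  obtain ⟨τ, hτ⟩ := C.exists_hasSyndrome E
  exact ⟨_, hτ.inSyndrome h⟩

/-- An error that takes a codeword into the eigenspace of `σ` has the syndrome `σ`. -/
lemma IsCodeword.hasSyndrome_of_inSyndrome {ψ : State (Fin n)} (h : C.IsCodeword ψ) (hψ : ψ ≠ 0)
    {D : PauliString (Fin n)} {σ : C.Syndrome} (hD : C.InSyndrome σ (D.op *ᵥ ψ)) :
    C.HasSyndrome D σ := by
  obtain ⟨τ, hτ⟩ := C.exists_hasSyndrome D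
  have h1 := hτ.inSyndrome (isCodeword_iff.1 h)
  rw [zero_add] at h1
  rwa [hD.unique h1 (PauliString.op_mulVec_ne_zero hψ D)]

/-! ### Correctable errors -/

lemma IsCodeword.stabilizer_mulVec {ψ : State (Fin n)} (h : C.IsCodeword ψ) {A : Oper (Fin n)}
    (hA : A ∈ C.stabilizer) : A *ᵥ ψ = ψ := by
  induction hA using Submonoid.closure_induction with
  | mem x hx => obtain ⟨i, rfl⟩ := hx; exact h i
  | one => exact Matrix.one_mulVec ψ
  | mul x y _ _ hx hy => rw [← Matrix.mulVec_mulVec, hy, hx]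

/-- A Pauli operator of weight less than the distance that has the trivial syndrome acts on the
codewords as a scalar. -/
lemma IsCodeword.exists_op_mulVec_eq_smul {ψ : State (Fin n)} (h : C.IsCodeword ψ) (hψ : ψ ≠ 0)
    {L : PauliString (Fin n)} (hL : C.HasSyndrome L 0) (hw : L.wt < C.distance) :
    ∃ c : ℂ, L.op *ᵥ ψ = c • ψ := by
  have h1 : ¬ C.IsNontrivialLogical L := fun h' => by
    have : C.distance ≤ L.wt := Nat.sInf_le ⟨L, h', rfl⟩
    omega
  have hcomm : ∀ i, Commute L.op (C.gen i) := fun i => by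
    have := hasSyndrome_iff.1 hL i
    rw [Pi.zero_apply, sgn_zero, one_smul] at this
    exact this.symm
  simp only [IsNontrivialLogical, not_and, not_forall, not_not] at h1
  obtain ⟨c, hc⟩ := h1 hcomm
  have h2 := h.stabilizer_mulVec hc
  rw [Matrix.smul_mulVec] at h2
  have hc0 : c ≠ 0 := by
    rintro rfl
    rw [zero_smul] at h2
    exact hψ h2.symm
  refine ⟨c⁻¹, ?_⟩
  conv_rhs => rw [← h2]
  rw [smul_smul, inv_mul_cancel₀ hc0, one_smul]

/-- Minimum weight correction undoes an error of weight less than half the distance. -/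
lemma IsCorrection.exists_mulVec_eq_smul {ψ : State (Fin n)} (h : C.IsCodeword ψ) (hψ : ψ ≠ 0)
    {D R : PauliString (Fin n)} {σ : C.Syndrome} (hR : C.IsCorrection σ R)
    (hD : C.InSyndrome σ (D.op *ᵥ ψ)) (hw : 2 * D.wt < C.distance) :
    ∃ c : ℂ, R.op *ᵥ (D.op *ᵥ ψ) = c • ψ := by
  have hRD := hR.2 D (h.hasSyndrome_of_inSyndrome hψ hD)
  obtain ⟨c, hc, hcL⟩ := PauliString.exists_op_mul R D
  have h1 : C.InSyndrome 0 ((R.prod D).op *ᵥ ψ) := by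
    have h2 := (hR.1.inSyndrome hD).smul c⁻¹
    rw [Matrix.mulVec_mulVec, hcL, Matrix.smul_mulVec, smul_smul, inv_mul_cancel₀ hc,
      one_smul] at h2
    have h3 : σ + σ = 0 := by
      funext i; exact CharTwo.add_self_eq_zero (σ i)
    rwa [h3] at h2
  obtain ⟨c', hc'⟩ := h.exists_op_mulVec_eq_smul hψ (h.hasSyndrome_of_inSyndrome hψ h1)
    (by have := PauliString.wt_prod_le R D; omega)
  exact ⟨c * c', by rw [Matrix.mulVec_mulVec, hcL, Matrix.smul_mulVec, hc', smul_smul]⟩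

/-- On an eigenstate each projector is the scalar 0 or 1, and it is 0 when the bits of `σ` and `τ`
differ. Thus ideal decoding can only observe the true syndrome. -/
lemma InSyndrome.exists_prod_mulVec {τ : C.Syndrome} {φ : State (Fin n)} (h : C.InSyndrome τ φ)
    (σ : C.Syndrome) (l : List (Fin r)) :
    ∃ z : ℂ, (l.map fun i => (1 / 2 : ℂ) • (1 + sgn (σ i) • C.gen i)).prod *ᵥ φ = z • φ ∧
      (z ≠ 0 → ∀ i ∈ l, σ i = τ i) := by
  induction l with
  | nil => exact ⟨1, by simp, by simp⟩
  | cons i l ih =>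
    obtain ⟨z, hz, hz'⟩ := ih
    refine ⟨1 / 2 * (1 + sgn (σ i) * sgn (τ i)) * z, ?_, ?_⟩
    · rw [List.map_cons, List.prod_cons, ← Matrix.mulVec_mulVec, hz, Matrix.mulVec_smul,
        Matrix.smul_mulVec, Matrix.add_mulVec, Matrix.one_mulVec, Matrix.smul_mulVec, h i]
      module
    · intro hne j hj
      rcases List.mem_cons.1 hj with rfl | hj
      · rcases zmod_two_cases (σ j) with hσ | hσ <;> rcases zmod_two_cases (τ j) with hτ | hτ <;>
          simp [hσ, hτ] at hne ⊢
      · exact hz' (right_ne_zero_of_mul hne) j hj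

lemma IdealDecode.exists_eq_smul {ψ φ ψ₁ : State (Fin n)} (h : C.IsCodeword ψ) (hψ : ψ ≠ 0)
    {D : PauliString (Fin n)} (hw : 2 * D.wt < C.distance) {c : ℂ} (hφ : φ = c • D.op *ᵥ ψ)
    (hd : C.IdealDecode φ ψ₁) : ∃ c' : ℂ, c' ≠ 0 ∧ ψ₁ = c' • ψ := by
  obtain ⟨σ, R, hR, h1, hne⟩ := hd
  obtain ⟨τ, hτ⟩ := exists_inSyndrome_op (isCodeword_iff.1 h) D
  have hτφ : C.InSyndrome τ φ := hφ ▸ hτ.smul c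
  obtain ⟨z, hz, hz'⟩ := hτφ.exists_prod_mulVec σ (List.finRange r)
  have hproj : C.syndromeProj σ *ᵥ φ = z • φ := by
    rw [← hz, syndromeProj, List.ofFn_eq_map]; rfl
  rw [hproj, hφ] at h1
  have hz0 : z ≠ 0 := by
    rintro rfl
    rw [zero_smul, Matrix.mulVec_zero] at h1
    exact hne h1
  have hστ : σ = τ := funext fun i => hz' hz0 i (List.mem_finRange i)
  subst hστ
  obtain ⟨c', hc'⟩ := hR.exists_mulVec_eq_smul h hψ hτ hw
  have h2 : ψ₁ = (z * c * c') • ψ := by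
    rw [h1, Matrix.mulVec_smul, Matrix.mulVec_smul, hc', smul_smul, smul_smul]
  refine ⟨_, ?_, h2⟩
  intro h0
  rw [h0, zero_smul] at h2
  exact hne h2

/-! ### Rounds of syndrome measurements -/

variable (C)

/-- The number of faults in a round. -/
def roundCount (F : C.RoundFaults) : ℕ := ∑ i, (F i).count

lemma exists_measure_eq (F : C.RoundFaults) (b : C.RoundResults) (i : Fin r) :
    ∃ (κ : ℂ) (E : PauliString (Fin n)) (e : ZMod 2),
      E.wt ≤ (F i).count ∧ ((F i).count = 0 → e = 0) ∧
      ∀ φ, afterMeasurement (C.pauli i) (F i) (b i) φ =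
        κ • E.op *ᵥ (φ + sgn (C.roundSyndrome F b i + e) • C.gen i *ᵥ φ) := by
  obtain ⟨κ, E, e, h1, h2, h3⟩ := exists_afterMeasurement_eq (F i) (b i)
  refine ⟨κ, E, e, h1, h2, fun φ => ?_⟩
  rw [h3, op_pauli_eq, roundSyndrome, Matrix.smul_mulVec, smul_smul, ← sgn_add]
  congr 5
  ring

/-- The generators commute, so a fault-free measurement of one preserves the eigenvector relations
already established for the others. The first half of the conclusion carries this through the
induction. -/
lemma foldl_measure_clean (F : C.RoundFaults) (b : C.RoundResults) (hF : ∀ i, (F i).count = 0)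
    (l : List (Fin r)) (φ : State (Fin n)) :
    (∀ j (a : ℂ), C.gen j *ᵥ φ = a • φ →
      C.gen j *ᵥ l.foldl (fun χ i => afterMeasurement (C.pauli i) (F i) (b i) χ) φ =
        a • l.foldl (fun χ i => afterMeasurement (C.pauli i) (F i) (b i) χ) φ) ∧
    ∀ j ∈ l, C.gen j *ᵥ l.foldl (fun χ i => afterMeasurement (C.pauli i) (F i) (b i) χ) φ =
      sgn (C.roundSyndrome F b j) •
        l.foldl (fun χ i => afterMeasurement (C.pauli i) (F i) (b i) χ) φ := by
  induction l generalizing φ with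
  | nil => simp
  | cons i l ih =>
    simp only [List.foldl_cons]
    obtain ⟨κ, E, e, h1, h2, h3⟩ := C.exists_measure_eq F b i
    have hstep : afterMeasurement (C.pauli i) (F i) (b i) φ =
        κ • (φ + sgn (C.roundSyndrome F b i) • C.gen i *ᵥ φ) := by
      rw [h3, h2 (hF i), add_zero, PauliString.op_of_wt_eq_zero (by have := hF i; omega),
        Matrix.one_mulVec]
    obtain ⟨ih1, ih2⟩ := ih (afterMeasurement (C.pauli i) (F i) (b i) φ)
    refine ⟨fun j a hj => ih1 j a ?_, fun j hj => ?_⟩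
    · rw [hstep, Matrix.mulVec_smul, Matrix.mulVec_add, Matrix.mulVec_smul, Matrix.mulVec_mulVec,
        C.gen_mul_comm j i, ← Matrix.mulVec_mulVec, hj, Matrix.mulVec_smul]
      module
    · rcases List.mem_cons.1 hj with rfl | hj
      · refine ih1 j _ ?_
        rw [hstep, Matrix.mulVec_smul, Matrix.mulVec_add, Matrix.mulVec_smul,
          Matrix.mulVec_mulVec, C.gen_mul_self, Matrix.one_mulVec, smul_add, smul_add, smul_add,
          smul_smul (sgn _) κ, smul_smul κ (sgn _), smul_comm (sgn _) κ (sgn _ • _),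
          smul_smul (sgn _) (sgn _), sgn_mul_self, one_smul, mul_comm, add_comm]
      · exact ih2 j hj

lemma inSyndrome_round (F : C.RoundFaults) (b : C.RoundResults) (hF : C.roundCount F = 0)
    (φ : State (Fin n)) : C.InSyndrome (C.roundSyndrome F b) (C.round F b φ) := by
  have hF' : ∀ i, (F i).count = 0 := by
    simpa [roundCount] using hF
  exact fun i => (C.foldl_measure_clean F b hF' _ φ).2 i (List.mem_finRange i)

variable {C}

/-- On an eigenstate `1 ± P` is a scalar, so a measurement leaves only its Pauli error. The result
is again an eigenstate, possibly with another syndrome, which keeps the induction going. -/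
lemma InSyndrome.exists_foldl_measure_eq (F : C.RoundFaults) (b : C.RoundResults)
    (l : List (Fin r)) {σ : C.Syndrome} {χ : State (Fin n)} (h : C.InSyndrome σ χ) :
    ∃ (c : ℂ) (E : PauliString (Fin n)), E.wt ≤ (l.map fun i => (F i).count).sum ∧
      l.foldl (fun χ i => afterMeasurement (C.pauli i) (F i) (b i) χ) χ = c • E.op *ᵥ χ := by
  induction l generalizing σ χ with
  | nil =>
    have hI := PauliString.wt_identity (Fin n)
    exact ⟨1, fun _ => .I, by simp [hI], by
      rw [PauliString.op_of_wt_eq_zero hI, one_smul, Matrix.one_mulVec]; rfl⟩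
  | cons i l ih =>
    obtain ⟨κ, E, e, h1, -, h3⟩ := C.exists_measure_eq F b i
    have hstep : afterMeasurement (C.pauli i) (F i) (b i) χ =
        (κ * (1 + sgn (C.roundSyndrome F b i + e) * sgn (σ i))) • E.op *ᵥ χ := by
      rw [h3, h i, smul_smul, Matrix.mulVec_add, Matrix.mulVec_smul]
      module
    obtain ⟨τ, hτ⟩ := exists_inSyndrome_op h E
    obtain ⟨c, E', hE', hc⟩ := ih (hτ.smul (κ * (1 + sgn (C.roundSyndrome F b i + e) * sgn (σ i))))
    obtain ⟨c', -, hc'⟩ := PauliString.exists_op_mul E' E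
    refine ⟨c * (κ * (1 + sgn (C.roundSyndrome F b i + e) * sgn (σ i))) * c', E'.prod E, ?_, ?_⟩
    · have := PauliString.wt_prod_le E' E
      rw [List.map_cons, List.sum_cons]
      omega
    · rw [List.foldl_cons, hstep, hc, Matrix.mulVec_smul, Matrix.mulVec_mulVec, hc',
        Matrix.smul_mulVec, smul_smul, smul_smul]

lemma InSyndrome.exists_round_eq (F : C.RoundFaults) (b : C.RoundResults) {σ : C.Syndrome}
    {χ : State (Fin n)} (h : C.InSyndrome σ χ) :
    ∃ (c : ℂ) (E : PauliString (Fin n)), E.wt ≤ C.roundCount F ∧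
      C.round F b χ = c • E.op *ᵥ χ := by
  obtain ⟨c, E, hE, hc⟩ := h.exists_foldl_measure_eq F b (List.finRange r)
  refine ⟨c, E, ?_, hc⟩
  rwa [← List.ofFn_eq_map, List.sum_ofFn] at hE

variable (C) in
lemma round_zero (F : C.RoundFaults) (b : C.RoundResults) : C.round F b 0 = 0 := by
  -- The zero vector lies in every eigenspace, so linearity of the round need not be proved
  -- separately.
  have h : C.InSyndrome 0 (0 : State (Fin n)) := fun i => by simp
  obtain ⟨c, E, -, hc⟩ := h.exists_round_eq F b
  rw [hc, Matrix.mulVec_zero, smul_zero]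

section Rounds

variable (F : ℕ → C.RoundFaults) (b : ℕ → C.RoundResults) (φ : State (Fin n))

lemma afterRounds_ne_zero {j m : ℕ} (hjm : j ≤ m) (h : C.afterRounds F b φ m ≠ 0) :
    C.afterRounds F b φ j ≠ 0 := by
  induction m, hjm using Nat.le_induction with
  | base => exact h
  | succ m _ ih =>
    refine ih fun h' => h ?_
    rw [afterRounds, h', round_zero]

lemma InSyndrome.exists_afterRounds_eq {j m : ℕ} (hjm : j ≤ m) {σ : C.Syndrome}
    (h : C.InSyndrome σ (C.afterRounds F b φ j)) :
    ∃ (c : ℂ) (E : PauliString (Fin n)), E.wt ≤ ∑ i ∈ Finset.Ico j m, C.roundCount (F i) ∧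
      C.afterRounds F b φ m = c • E.op *ᵥ C.afterRounds F b φ j := by
  induction m, hjm using Nat.le_induction with
  | base =>
    have hI := PauliString.wt_identity (Fin n)
    exact ⟨1, fun _ => .I, by simp [hI], by
      rw [PauliString.op_of_wt_eq_zero hI, one_smul, Matrix.one_mulVec]⟩
  | succ m hjm ih =>
    obtain ⟨c, E, hE, hc⟩ := ih
    obtain ⟨τ, hτ⟩ := exists_inSyndrome_op h E
    have hτ' : C.InSyndrome τ (C.afterRounds F b φ m) := hc ▸ hτ.smul c
    obtain ⟨c', E', hE', hc'⟩ := hτ'.exists_round_eq (F m) (b m)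
    obtain ⟨c'', -, hc''⟩ := PauliString.exists_op_mul E' E
    refine ⟨c' * c * c'', E'.prod E, ?_, ?_⟩
    · have := PauliString.wt_prod_le E' E
      rw [Finset.sum_Ico_succ_top hjm]
      omega
    · rw [afterRounds, hc', hc, Matrix.mulVec_smul, Matrix.mulVec_mulVec, hc'',
        Matrix.smul_mulVec, smul_smul, smul_smul]

lemma inSyndrome_afterRounds_succ {j : ℕ} (hj : C.roundCount (F j) = 0) :
    C.InSyndrome (C.roundSyndrome (F j) (b j)) (C.afterRounds F b φ (j + 1)) :=
  C.inSyndrome_round (F j) (b j) hj _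

/-- If two consecutive rounds have different syndromes, then there is a fault in one of them. -/
lemma one_le_roundCount_add {i m : ℕ} (hi : i + 1 < m) (h : C.afterRounds F b φ m ≠ 0)
    (hs : C.roundSyndrome (F (i + 1)) (b (i + 1)) ≠ C.roundSyndrome (F i) (b i)) :
    1 ≤ C.roundCount (F i) + C.roundCount (F (i + 1)) := by
  by_contra! hlt
  have h1 := inSyndrome_afterRounds_succ F b φ (j := i) (by omega)
  have h2 := inSyndrome_afterRounds_succ F b φ (j := i + 1) (by omega)
  obtain ⟨c, E, hE, hc⟩ := h1.exists_round_eq (F (i + 1)) (b (i + 1))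
  rw [PauliString.op_of_wt_eq_zero (by omega), Matrix.one_mulVec] at hc
  have h3 : C.InSyndrome (C.roundSyndrome (F i) (b i)) (C.afterRounds F b φ (i + 1 + 1)) := by
    rw [afterRounds, hc]
    exact h1.smul c
  exact hs (h2.unique h3 (afterRounds_ne_zero F b φ (by omega) h))

end Rounds

end StabilizerCode

/-! ### Difference vectors and the number of faults -/

/-- If every one in a string is caused by a fault in one of the two adjacent rounds, then there are
at least `minFaults` faults. -/
lemma minFaults_le_sum (l : List Bool) (f : ℕ → ℕ)
    (h : ∀ i, l[i]? = some true → 1 ≤ f i + f (i + 1)) :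
    minFaults l ≤ ∑ j ∈ Finset.range (l.length + 1), f j := by
  match l with
  | [] => simp [minFaults, pairs11, remainingOnes]
  | [true] =>
    have := h 0 rfl
    simp [minFaults, pairs11, remainingOnes, Finset.sum_range_succ]
    omega
  | true :: true :: l =>
    have h0 : 1 ≤ f 0 + f 1 := h 0 rfl
    -- Two letters are consumed along with the rounds 0 and 1, which already contain a fault. The
    -- second one of the pair yields no further count, since the same fault may cause it.
    have ih := minFaults_le_sum l (fun i => f (i + 2)) fun i hi => h (i + 2) (by simpa using hi)
    simp only [minFaults, pairs11, remainingOnes, List.length_cons] at ih ⊢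
    rw [Finset.sum_range_succ', Finset.sum_range_succ']
    simp only [Nat.add_assoc, Nat.reduceAdd] at ih ⊢
    omega
  | true :: false :: l =>
    have h0 : 1 ≤ f 0 + f 1 := h 0 rfl
    have ih := minFaults_le_sum l (fun i => f (i + 2)) fun i hi => h (i + 2) (by simpa using hi)
    simp only [minFaults, pairs11, remainingOnes, List.length_cons] at ih ⊢
    rw [Finset.sum_range_succ', Finset.sum_range_succ']
    simp only [Nat.add_assoc, Nat.reduceAdd] at ih ⊢
    omega
  | false :: l =>
    have ih := minFaults_le_sum l (fun i => f (i + 1)) fun i hi => h (i + 1) (by simpa using hi)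
    simp only [minFaults, pairs11, remainingOnes, List.length_cons] at ih ⊢
    rw [Finset.sum_range_succ']
    omega

lemma minFaults_nil : minFaults [] = 0 := rfl

/-- Dropping the last letter breaks at most one pair, and the one left over still counts. Hence the
faults forced by the pairs occur without the help of the last round. -/
lemma pairs11_le_minFaults_dropLast (l : List Bool) : pairs11 l ≤ minFaults l.dropLast := by
  match l with
  | [] => simp [pairs11]
  | [true] => simp [pairs11]
  | [true, true] => simp [pairs11, minFaults, remainingOnes]
  | true :: true :: a :: l =>
    have ih := pairs11_le_minFaults_dropLast (a :: l)
    simp only [List.dropLast_cons_cons]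
    simp only [minFaults, pairs11, remainingOnes] at ih ⊢
    omega
  | [true, false] => simp [pairs11]
  | true :: false :: a :: l =>
    have ih := pairs11_le_minFaults_dropLast (a :: l)
    simp only [List.dropLast_cons_cons]
    simp only [minFaults, pairs11, remainingOnes] at ih ⊢
    omega
  | [false] => simp [pairs11]
  | false :: a :: l =>
    have ih := pairs11_le_minFaults_dropLast (a :: l)
    simp only [List.dropLast_cons_cons]
    simp only [minFaults, pairs11, remainingOnes] at ih ⊢
    omega

section DiffVec

variable {S : Type} [DecidableEq S]

lemma length_diffVec (s : ℕ → S) (m : ℕ) : (diffVec s m).length = m - 1 := by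
  simp [diffVec]

lemma diffVec_getElem? (s : ℕ → S) (m i : ℕ) (a : Bool) :
    (diffVec s m)[i]? = some a ↔ i < m - 1 ∧ decide (s (i + 1) ≠ s i) = a := by
  simp only [diffVec, List.getElem?_map, Option.map_eq_some_iff, List.getElem?_eq_some_iff,
    List.length_range, List.getElem_range]
  constructor
  · rintro ⟨x, ⟨h, rfl⟩, rfl⟩
    exact ⟨h, rfl⟩
  · rintro ⟨h, rfl⟩
    exact ⟨i, ⟨h, rfl⟩, rfl⟩

/-- If there are at most `t` faults when the protocol stops, then the syndrome that is used is also
the syndrome of a round without faults. -/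
lemma exists_clean_round {s : ℕ → S} {f : ℕ → ℕ} {t m k : ℕ} (hm : 1 ≤ m)
    (hf : ∀ i, i + 1 < m → s (i + 1) ≠ s i → 1 ≤ f i + f (i + 1))
    (hsum : ∑ j ∈ Finset.range m, f j ≤ t) (hk : StopsWith t (diffVec s m) k) :
    ∃ j < m, f j = 0 ∧ s j = s k := by
  rcases hk with ⟨A, γ, B, ⟨hδ, hγ, hA, hB, ht⟩, hk1, hk2⟩ | ⟨hp, hk⟩
  · have hlen : m - 1 = A.length + γ + B.length := by
      rw [← length_diffVec s m, hδ]; simp [Nat.add_assoc]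
    have hz : ∀ i, A.length ≤ i → i < A.length + γ → s (i + 1) = s i := by
      intro i h1 h2
      have h3 : (diffVec s m)[i]? = some false := by
        rw [hδ, List.getElem?_append_left (by simp; omega), List.getElem?_append_right h1,
          List.getElem?_replicate, if_pos (by omega)]
      have := ((diffVec_getElem? s m i false).1 h3).2
      simpa using this
    have hconst : ∀ i, A.length ≤ i → i ≤ A.length + γ → s i = s A.length := by
      intro i h1
      induction i, h1 using Nat.le_induction with
      | base => intro _; rfl
      | succ i h1 ih => intro h2; rw [hz i h1 (by omega), ih (by omega)]
    -- Without its last one, `A` concerns only the rounds before `A.length`, the first round of `η`.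
    -- Likewise `B.tail` below starts just after the last round of `η`.
    have hAf : minFaults A.dropLast ≤ ∑ j ∈ Finset.range A.length, f j := by
      rcases A.eq_nil_or_concat with rfl | ⟨A', a, rfl⟩
      · simp [minFaults_nil]
      · simp only [List.concat_eq_append, List.dropLast_concat, List.length_append,
          List.length_singleton] at hδ hlen ⊢
        refine minFaults_le_sum A' f fun i hi => ?_
        have hi' := (List.getElem?_eq_some_iff.1 hi).1
        have h3 : (diffVec s m)[i]? = some true := by
          rw [hδ, List.append_assoc, List.append_assoc, List.getElem?_append_left hi', hi]
        obtain ⟨h4, h5⟩ := (diffVec_getElem? s m i true).1 h3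
        exact hf i (by omega) (by simpa using h5)
    have hBf : minFaults B.tail ≤
        ∑ j ∈ Finset.range B.length, f (A.length + γ + 1 + j) := by
      rcases B with _ | ⟨a, B'⟩
      · simp [minFaults_nil]
      · simp only [List.tail_cons, List.length_cons] at hlen ⊢
        refine minFaults_le_sum B' (fun j => f (A.length + γ + 1 + j)) fun i hi => ?_
        have hi' := (List.getElem?_eq_some_iff.1 hi).1
        have h3 : (diffVec s m)[A.length + γ + 1 + i]? = some true := by
          rw [hδ, List.getElem?_append_right (by simp; omega)]
          simp only [List.length_append, List.length_replicate]
          rw [show A.length + γ + 1 + i - (A.length + γ) = i + 1 by omega,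
            List.getElem?_cons_succ, hi]
        obtain ⟨h4, h5⟩ := (diffVec_getElem? s m _ true).1 h3
        exact hf _ (by omega) (by simpa using h5)
    -- All `γ + 1` rounds of `η` have the syndrome of round `k`. If none is clean, the three
    -- disjoint blocks of rounds contain at least `α + β + γ + 1 > t` faults.
    by_contra! hcon
    have hmid : ∀ j ∈ Finset.range (γ + 1), 1 ≤ f (A.length + j) := by
      intro j hj
      rw [Finset.mem_range] at hj
      have h1 : s (A.length + j) = s k := by
        rw [hconst _ (by omega) (by omega), hconst k hk1 hk2]
      by_contra h2
      exact hcon (A.length + j) (by omega) (by omega) h1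
    have hmid' := Finset.card_nsmul_le_sum _ _ _ hmid
    rw [Finset.card_range, smul_eq_mul, mul_one] at hmid'
    rw [show m = A.length + (γ + 1) + B.length by omega, Finset.sum_range_add,
      Finset.sum_range_add] at hsum
    simp only [Nat.add_assoc] at hsum hBf
    omega
  · rw [length_diffVec] at hk
    have h1 := pairs11_le_minFaults_dropLast (diffVec s m)
    refine ⟨m - 1, by omega, ?_, by rw [hk]⟩
    -- A single round has an empty difference vector, so stopping there forces `t = 0`; in general
    -- `minFaults_le_sum` needs a round before the last one.
    rcases Nat.lt_or_ge m 2 with h2 | h2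
    · obtain rfl : m = 1 := by omega
      have h3 : pairs11 (diffVec s 1) = 0 := rfl
      rw [Finset.sum_range_one] at hsum
      show f 0 = 0
      omega
    · obtain ⟨m', rfl⟩ := Nat.exists_eq_add_of_le' h2
      have h3 : minFaults (diffVec s (m' + 2)).dropLast ≤
          ∑ j ∈ Finset.range ((diffVec s (m' + 2)).dropLast.length + 1), f j := by
        refine minFaults_le_sum _ f fun i hi => ?_
        obtain ⟨hi', hi''⟩ := List.getElem?_eq_some_iff.1 hi
        rw [List.getElem_dropLast] at hi''
        rw [List.length_dropLast, length_diffVec] at hi'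
        obtain ⟨h4, h5⟩ := (diffVec_getElem? s (m' + 2) i true).1
          (List.getElem?_eq_some_iff.2 ⟨_, hi''⟩)
        exact hf i (by omega) (by simpa using h5)
      rw [List.length_dropLast, length_diffVec, show m' + 2 - 1 - 1 + 1 = m' + 1 by omega] at h3
      rw [Finset.sum_range_succ] at hsum
      show f (m' + 1) = 0
      omega

end DiffVec

/-! ### Fault tolerance of the protocol -/

namespace StabilizerCode

variable {n r : ℕ} {C : StabilizerCode n r}

/-- Since `R` commutes up to sign with the error `E` accumulated after the clean round `j`, the run
is equivalent to correcting right after round `j` and then suffering one error. The fault budget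
splits accordingly into the rounds up to `j` and the weight of this error. -/
lemma exists_clean_inSyndrome {t N s : ℕ} (hs : s ≤ t) {φ φ' : State (Fin n)}
    (h : C.adaptiveStrong t N s φ φ') :
    ∃ (F : ℕ → C.RoundFaults) (b : ℕ → C.RoundResults) (j : ℕ) (σ : C.Syndrome)
      (R E : PauliString (Fin n)) (c : ℂ),
      C.InSyndrome σ (C.afterRounds F b φ (j + 1)) ∧ C.IsCorrection σ R ∧
      C.afterRounds F b φ (j + 1) ≠ 0 ∧
      (∑ i ∈ Finset.range (j + 1), C.roundCount (F i)) + E.wt ≤ s ∧ c ≠ 0 ∧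
      φ' = c • E.op *ᵥ (R.op *ᵥ C.afterRounds F b φ (j + 1)) := by
  obtain ⟨F, b, m, k, R, G, hm, -, -, hk, hR, hφ', hne, hcount⟩ := h
  have hm0 : C.afterRounds F b φ m ≠ 0 := by
    intro h0
    rw [h0, Matrix.mulVec_zero, Matrix.mulVec_zero] at hφ'
    exact hne hφ'
  have hcount' : s = (∑ j ∈ Finset.range m, C.roundCount (F j)) + G.wt := hcount
  obtain ⟨j, hj, hj0, hjk⟩ := exists_clean_round (f := fun j => C.roundCount (F j)) hm
    (fun i hi hs => one_le_roundCount_add F b φ hi hm0 hs) (by omega) hk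
  have hσ := inSyndrome_afterRounds_succ F b φ hj0
  obtain ⟨c, E, hE, hc⟩ := hσ.exists_afterRounds_eq F b φ (show j + 1 ≤ m by omega)
  obtain ⟨a, ha⟩ := PauliString.exists_op_mul_comm R E
  obtain ⟨c', -, hc'⟩ := PauliString.exists_op_mul G E
  have hsplit := Finset.sum_range_add_sum_Ico (fun i => C.roundCount (F i))
    (show j + 1 ≤ m by omega)
  have hfin : φ' = (c * sgn a * c') • (G.prod E).op *ᵥ
      (R.op *ᵥ C.afterRounds F b φ (j + 1)) := by
    rw [hφ', hc, Matrix.mulVec_smul, Matrix.mulVec_smul, Matrix.mulVec_mulVec _ R.op, ha,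
      Matrix.smul_mulVec, Matrix.mulVec_smul, ← Matrix.mulVec_mulVec, Matrix.mulVec_mulVec _ G.op,
      hc', Matrix.smul_mulVec, smul_smul, smul_smul]
  refine ⟨F, b, j, _, R, G.prod E, c * sgn a * c', hσ, ?_,
    afterRounds_ne_zero F b φ (by omega) hm0, ?_, ?_, hfin⟩
  · rw [hjk]; exact hR
  · have := PauliString.wt_prod_le G E
    omega
  · intro h0
    rw [h0, zero_smul] at hfin
    exact hne hfin

/-- For ECCP, the error present after the clean round is correctable with its true syndrome, so `R`
restores the codeword and the remaining error is itself correctable. For ECRP, `R` moves the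
eigenspace of `σ` to the code space whatever the input was, and only the faults after the clean
round remain. -/
theorem stronglyFaultTolerant_adaptiveStrong (hd : C.distance ≠ 0) (N : ℕ) :
    C.StronglyFaultTolerant ((C.distance - 1) / 2)
      (C.adaptiveStrong ((C.distance - 1) / 2) N) := by
  refine ⟨le_rfl, ?_, ?_⟩
  · intro s E ψ φ' hψ hψ0 hw hP ψ₁ ψ₂ h1 h2
    obtain ⟨F, b, j, σ, R, E', c, hσ, hR, hne, hcount, hc, hφ'⟩ :=
      exists_clean_inSyndrome (by omega) hP
    obtain ⟨τ, hτ⟩ := exists_inSyndrome_op (isCodeword_iff.1 hψ) E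
    obtain ⟨c₁, D, hD, hc₁⟩ := InSyndrome.exists_afterRounds_eq F b (E.op *ᵥ ψ)
      (Nat.zero_le (j + 1)) (j := 0) hτ
    obtain ⟨c₂, hc₂0, hc₂⟩ := PauliString.exists_op_mul D E
    have hDE : C.afterRounds F b (E.op *ᵥ ψ) (j + 1) = (c₁ * c₂) • (D.prod E).op *ᵥ ψ := by
      rw [hc₁, afterRounds, Matrix.mulVec_mulVec, hc₂, Matrix.smul_mulVec, smul_smul]
    have hcc : c₁ * c₂ ≠ 0 := by
      intro h0
      rw [h0, zero_smul] at hDE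
      exact hne hDE
    have hσ' : C.InSyndrome σ ((D.prod E).op *ᵥ ψ) := by
      have := hσ.smul (c₁ * c₂)⁻¹
      rwa [hDE, smul_smul, inv_mul_cancel₀ hcc, one_smul] at this
    rw [← Finset.range_eq_Ico] at hD
    have hwt := PauliString.wt_prod_le D E
    obtain ⟨c₃, hc₃⟩ := hR.exists_mulVec_eq_smul hψ hψ0 hσ' (by omega)
    have hφ'' : φ' = (c * (c₁ * c₂ * c₃)) • E'.op *ᵥ ψ := by
      rw [hφ', hDE, Matrix.mulVec_smul, hc₃, smul_smul, Matrix.mulVec_smul, smul_smul]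
    obtain ⟨a, ha, ha'⟩ := h1.exists_eq_smul hψ hψ0 (D := E) (c := 1) (by omega)
      (by rw [one_smul])
    obtain ⟨a', ha2, ha2'⟩ := h2.exists_eq_smul hψ hψ0 (by omega) hφ''
    refine ⟨a' * a⁻¹, mul_ne_zero ha2 (inv_ne_zero ha), ?_⟩
    rw [ha', smul_smul, mul_assoc, inv_mul_cancel₀ ha, mul_one, ha2']
  · intro s φ φ' hs hP
    obtain ⟨F, b, j, σ, R, E', c, hσ, hR, -, hcount, -, hφ'⟩ := exists_clean_inSyndrome hs hP
    refine ⟨c • R.op *ᵥ C.afterRounds F b φ (j + 1), E', ?_, by omega, ?_⟩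
    · rw [isCodeword_iff]
      have := (hR.1.inSyndrome hσ).smul c
      rwa [show σ + σ = 0 from funext fun i => CharTwo.add_self_eq_zero (σ i)] at this
    · rw [hφ', Matrix.mulVec_smul]

end StabilizerCode

/-! ### Strings without usable zero substrings -/

lemma minFaults_le_append (l τ : List Bool) : minFaults l ≤ minFaults (l ++ τ) := by
  match l with
  | [] => simp [minFaults_nil]
  | [true] =>
    rcases τ with _ | ⟨_ | _, τ⟩ <;> simp [minFaults, pairs11, remainingOnes] <;> omega
  | true :: true :: l =>
    have ih := minFaults_le_append l τ
    simp only [List.cons_append, minFaults, pairs11, remainingOnes] at ih ⊢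
    omega
  | true :: false :: l =>
    have ih := minFaults_le_append l τ
    simp only [List.cons_append, minFaults, pairs11, remainingOnes] at ih ⊢
    omega
  | false :: l =>
    have ih := minFaults_le_append l τ
    simp only [List.cons_append, minFaults, pairs11, remainingOnes] at ih ⊢
    omega

/-- No pair `11` straddles a zero, so the greedy count splits there. The additivity over runs of
ones rests on this. -/
lemma minFaults_append_false_cons (l τ : List Bool) :
    minFaults (l ++ false :: τ) = minFaults l + minFaults τ := by
  match l with
  | [] => simp [minFaults, pairs11, remainingOnes]
  | [true] =>
    simp only [List.cons_append, List.nil_append, minFaults, pairs11, remainingOnes]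
    omega
  | true :: true :: l =>
    have ih := minFaults_append_false_cons l τ
    simp only [List.cons_append, minFaults, pairs11, remainingOnes] at ih ⊢
    omega
  | true :: false :: l =>
    have ih := minFaults_append_false_cons l τ
    simp only [List.cons_append, minFaults, pairs11, remainingOnes] at ih ⊢
    omega
  | false :: l =>
    have ih := minFaults_append_false_cons l τ
    simp only [List.cons_append, minFaults, pairs11, remainingOnes] at ih ⊢
    omega

lemma pairs11_replicate_true (m : ℕ) : pairs11 (List.replicate m true) = m / 2 := by
  match m with
  | 0 => rfl
  | 1 => rfl
  | m + 2 =>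
    have ih := pairs11_replicate_true m
    simp only [List.replicate_succ, pairs11, ih]
    omega

lemma minFaults_replicate_true (m : ℕ) : minFaults (List.replicate m true) = (m + 1) / 2 := by
  match m with
  | 0 => rfl
  | 1 => rfl
  | m + 2 =>
    have ih := minFaults_replicate_true m
    simp only [List.replicate_succ, minFaults, pairs11, remainingOnes] at ih ⊢
    omega

lemma minFaults_replicate_false_append (γ : ℕ) (l : List Bool) :
    minFaults (List.replicate γ false ++ l) = minFaults l := by
  induction γ with
  | zero => simp
  | succ γ ih =>
    rw [List.replicate_succ, List.cons_append, ← ih]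
    rfl

lemma minFaults_replicate_true_append (m : ℕ) {l : List Bool}
    (hl : l = [] ∨ l.head? = some false) :
    minFaults (List.replicate m true ++ l) = (m + 1) / 2 + minFaults l := by
  rcases l with _ | ⟨_ | _, l⟩
  · simp [minFaults_nil, minFaults_replicate_true]
  · rw [minFaults_append_false_cons, minFaults_replicate_true]
    rfl
  · simp at hl

lemma minFaults_append_of_getLast {A : List Bool} (hA : A = [] ∨ A.getLast? = some false)
    (l : List Bool) : minFaults (A ++ l) = minFaults A + minFaults l := by
  rcases A.eq_nil_or_concat with rfl | ⟨A', a, rfl⟩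
  · simp [minFaults_nil]
  · have ha : a = false := by simpa using hA
    subst ha
    rw [List.concat_eq_append, List.append_assoc, List.singleton_append,
      minFaults_append_false_cons, minFaults_append_false_cons, minFaults_nil, add_zero]

lemma exists_eq_replicate_append (b : Bool) (l : List Bool) :
    ∃ m l', l = List.replicate m b ++ l' ∧ (l' = [] ∨ l'.head? = some !b) := by
  induction l with
  | nil => exact ⟨0, [], by simp⟩
  | cons a l ih =>
    by_cases h : a = b
    · obtain ⟨m, l', rfl, h'⟩ := ih
      exact ⟨m + 1, l', by rw [h, List.replicate_succ, List.cons_append], h'⟩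
    · exact ⟨0, a :: l, by simp, Or.inr (by revert h; cases a <;> cases b <;> simp)⟩

/-- Appending letters cannot decrease `β`; if the run was at the end, it absorbs the leading zeros
of the extension. So one long string without usable run settles all its prefixes. -/
lemma FindsUsable.of_prefix {t : ℕ} {δ' δ : List Bool} (hp : δ' <+: δ) (h : FindsUsable t δ') :
    FindsUsable t δ := by
  obtain ⟨τ, rfl⟩ := hp
  obtain ⟨A, γ, B, rfl, hγ, hA, hB, ht⟩ := h
  rcases B with _ | ⟨b, B⟩
  · obtain ⟨k, τ', rfl, hτ'⟩ := exists_eq_replicate_append false τ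
    refine ⟨A, γ + k, τ', ?_, by omega, hA, hτ', ?_⟩
    · rw [← List.replicate_append_replicate]; simp only [List.append_nil, List.append_assoc]
    · rw [List.tail_nil, minFaults_nil] at ht
      omega
  · refine ⟨A, γ, b :: B ++ τ, by simp, hγ, hA, Or.inr (by simpa using hB), ?_⟩
    have := minFaults_le_append B τ
    rw [List.cons_append, List.tail_cons]
    rw [List.tail_cons] at ht
    omega

/-- The part of a string that starts with a zero substring, if no zero substring is usable. Here `p`
is the number of zero substrings, and `t - d` is the number of faults leading to the string. -/
lemma length_le_of_not_findsUsable {t : ℕ} (N : ℕ) : ∀ (A : List Bool) (m : ℕ) (S : List Bool),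
    S.length ≤ N → (A = [] ∨ A.getLast? = some false) → (A = [] ∨ 1 ≤ m) →
    S.head? = some false → ¬ FindsUsable t (A ++ List.replicate m true ++ S) →
    ∃ p d, p ≤ minFaults S + 1 ∧ minFaults (A ++ List.replicate m true ++ S) + d = t ∧
      S.length + 1 ≤ p * d + 2 * minFaults S + m % 2 := by
  induction N with
  | zero =>
    intro A m S hS _ _ hS' _
    have : S = [] := List.length_eq_zero_iff.1 (by omega)
    simp [this] at hS'
  | succ N ih =>
    intro A m S hS hA hAm hS' hδ
    obtain ⟨γ, L, rfl, hL⟩ := exists_eq_replicate_append false S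
    obtain ⟨m', S', rfl, hS''⟩ := exists_eq_replicate_append true L
    simp only [Bool.not_false, Bool.not_true] at hL hS''
    have hγ : 0 < γ := by
      by_contra h
      obtain rfl : γ = 0 := by omega
      simp only [List.replicate_zero, List.nil_append] at hS'
      rcases hL with hL | hL
      · simp [hL] at hS'
      · simp [hL] at hS'
    have hm' : S' = [] ∨ 1 ≤ m' := by
      by_contra! h
      obtain rfl : m' = 0 := by omega
      simp only [List.replicate_zero, List.nil_append] at hL
      rcases hL with hL | hL
      · exact h.1 hL
      · rcases hS'' with h' | h'
        · exact h.1 h'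
        · simp [hL] at h'
    have hMS : minFaults (List.replicate γ false ++ (List.replicate m' true ++ S')) =
        (m' + 1) / 2 + minFaults S' := by
      rw [minFaults_replicate_false_append, minFaults_replicate_true_append _ hS'']
    have hM : minFaults (A ++ List.replicate m true ++
        (List.replicate γ false ++ (List.replicate m' true ++ S'))) =
        minFaults A + ((m + 1) / 2 + ((m' + 1) / 2 + minFaults S')) := by
      rw [List.append_assoc, minFaults_append_of_getLast hA,
        minFaults_replicate_true_append _ (Or.inr hS'), hMS]
    have hα : minFaults (A ++ List.replicate m true).dropLast = minFaults A + m / 2 := by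
      rcases m with _ | m
      · obtain rfl : A = [] := by simpa using hAm
        simp [minFaults_nil]
      · rw [List.replicate_succ', ← List.append_assoc, List.dropLast_concat,
          minFaults_append_of_getLast hA, minFaults_replicate_true]
    have hβ : minFaults (List.replicate m' true ++ S').tail = m' / 2 + minFaults S' := by
      rcases m' with _ | m'
      · obtain rfl : S' = [] := by simpa using hm'
        simp [minFaults_nil]
      · rw [List.replicate_succ, List.cons_append, List.tail_cons,
          minFaults_replicate_true_append _ hS'']
    -- Removing the ones next to the zero run turns `(m + 1) / 2` and `(m' + 1) / 2` into `m / 2`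
    -- and `m' / 2`. This rounding is the only difference from the total count.
    have hrun : minFaults A + m / 2 + (m' / 2 + minFaults S') + γ < t := by
      by_contra! h
      refine hδ ⟨A ++ List.replicate m true, γ, List.replicate m' true ++ S', by simp, hγ, ?_, hL,
        ?_⟩
      · rcases m with _ | m
        · left; simpa using hAm
        · right; rw [List.replicate_succ', ← List.append_assoc]; simp
      · omega
    rw [hM, hMS]
    simp only [List.length_append, List.length_replicate] at hS ⊢
    rcases S' with _ | ⟨b, S'⟩
    · obtain ⟨d, hd⟩ : ∃ d, minFaults A + ((m + 1) / 2 + ((m' + 1) / 2 + minFaults [])) + d = t :=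
        Nat.exists_eq_add_of_le (by omega) |>.imp fun _ h => h.symm
      refine ⟨1, d, by omega, hd, ?_⟩
      simp only [List.length_nil]
      omega
    · obtain ⟨p, d, hp, hd, hlen⟩ := ih (A ++ List.replicate m true ++ List.replicate γ false) m'
        (b :: S') (by omega) (Or.inr (by simp [List.getLast?_replicate, hγ.ne'])) (Or.inr (by simpa using hm'))
        (by simpa using hS'') (by simpa using hδ)
      have hd' : minFaults A + ((m + 1) / 2 + ((m' + 1) / 2 + minFaults (b :: S'))) + d = t := by
        rw [← hd, ← hM]
        simp
      have hm'' : 1 ≤ m' := by simpa using hm'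
      -- The parity of `m'` enters twice, through this zero run and through the next. One copy
      -- completes `m'` to `2 * ((m' + 1) / 2)`, the other is offset by the strict inequality in
      -- `hrun`.
      refine ⟨p + 1, d, by omega, hd', ?_⟩
      rw [Nat.succ_mul]
      omega

/-- The left side plus one is `(K + 1) * (d + 2)`, whose factors have the fixed sum `t + 3` for `t =
K + d`; the product is largest when they are as equal as parity allows. -/
lemma le_numRounds (K d : ℕ) : (K + 1) * d + 2 * K + 1 ≤ numRounds (K + d) := by
  unfold numRounds
  split_ifs with h
  · obtain ⟨u, hu⟩ := h
    rw [show (K + d + 3) / 2 = u + 2 by omega]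
    refine Nat.le_sub_of_add_le ?_
    zify at hu ⊢
    have hd : (d : ℤ) = 2 * u + 1 - K := by linarith
    rw [hd]
    nlinarith [sq_nonneg ((K : ℤ) - u - 1)]
  · obtain ⟨u, hu⟩ := Nat.not_odd_iff_even.1 h
    rw [show (K + d + 2) / 2 = u + 1 by omega, show (K + d + 4) / 2 = u + 2 by omega]
    refine Nat.le_sub_of_add_le ?_
    zify at hu ⊢
    have hd : (d : ℤ) = 2 * u - K := by linarith
    rw [hd]
    -- The deficit is `(K - u) * (K - u - 1)`, nonnegative because no integer lies strictly between
    -- `u` and `u + 1`.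
    rcases le_or_gt (K : ℤ) u with h1 | h1
    · nlinarith [mul_nonneg (sub_nonneg.2 h1) (show (0 : ℤ) ≤ u + 1 - K by linarith)]
    · have h2 : (0 : ℤ) ≤ K - u - 1 := by linarith
      nlinarith [mul_nonneg h2 (show (0 : ℤ) ≤ K - u by linarith)]

/-- An upper bound on the length of the strings with a zero and without usable zero substring. -/
lemma length_add_two_le_numRounds {t : ℕ} {δ : List Bool} (h0 : false ∈ δ)
    (h : ¬ FindsUsable t δ) : δ.length + 2 ≤ numRounds t := by
  obtain ⟨m, S, rfl, hS⟩ := exists_eq_replicate_append true δ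
  have hS' : S.head? = some false := by
    rcases hS with rfl | hS
    · simp at h0
    · exact hS
  obtain ⟨p, d, hp, hd, hlen⟩ := length_le_of_not_findsUsable S.length [] m S le_rfl (Or.inl rfl)
    (Or.inl rfl) hS' (by simpa using h)
  rw [List.nil_append, minFaults_replicate_true_append m (Or.inr hS')] at hd
  have h1 := le_numRounds ((m + 1) / 2 + minFaults S) d
  rw [hd] at h1
  have h2 : p * d ≤ ((m + 1) / 2 + minFaults S + 1) * d := Nat.mul_le_mul_right _ (by omega)
  simp only [List.length_append, List.length_replicate]
  omega

/-- Strings of ones alone escape the search for usable runs; the second stopping condition limits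
them to length `2 * t - 1`, which is within the bound by the case `d = 0` of `le_numRounds`. -/
lemma length_add_two_le_numRounds_of_forall_prefix {t : ℕ} {δ : List Bool}
    (h : ∀ δ' : List Bool, δ' <+: δ → ¬ Stops t δ') : δ.length + 2 ≤ numRounds t := by
  by_cases h0 : false ∈ δ
  · exact length_add_two_le_numRounds h0 fun h' => h δ List.prefix_rfl (Or.inl h')
  · have h1 : δ = List.replicate δ.length true := by
      refine List.eq_replicate_iff.2 ⟨rfl, fun b hb => ?_⟩
      cases b
      · exact absurd hb h0
      · rfl
    have h2 : δ.length < 2 * t := by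
      by_contra! hlt
      refine h (List.replicate (2 * t) true) ?_ (Or.inr (by rw [pairs11_replicate_true]; omega))
      rw [h1]
      exact ⟨List.replicate (δ.length - 2 * t) true, by
        rw [List.replicate_append_replicate]; congr 1; omega⟩
    have h3 := le_numRounds t 0
    rw [add_zero] at h3
    omega

/-! ### The longest strings without usable zero substrings -/

/-- The string of length `l` with ones at the positions `a`, `a + (a + 2)`, `a + 2 (a + 2)`, …. -/
def periodicString (a l : ℕ) : List Bool := (List.range l).map fun i => decide (i ≡ a [MOD a + 2])

lemma length_periodicString (a l : ℕ) : (periodicString a l).length = l := by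
  simp [periodicString]

lemma periodicString_getElem? {a l i : ℕ} {b : Bool} (h : (periodicString a l)[i]? = some b) :
    decide (i % (a + 2) = a) = b := by
  obtain ⟨h1, rfl⟩ := List.getElem?_eq_some_iff.1 h
  simp [periodicString, Nat.ModEq, Nat.mod_eq_of_lt (show a < a + 2 by omega)]

lemma count_periodicString_le (a k l : ℕ) (hl : l ≤ k * (a + 2) + a) :
    (periodicString a l).count true ≤ k := by
  have h1 : (periodicString a l).count true = Nat.count (· ≡ a [MOD a + 2]) l := by
    rw [periodicString, List.count, List.countP_map, Nat.count]
    congr 1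
    funext i
    simp
  have h2 : Nat.count (· ≡ a [MOD a + 2]) (k * (a + 2) + a) = k := by
    rw [Nat.count_modEq_card _ (by omega), Nat.mod_eq_of_lt (show a < a + 2 by omega),
      mul_comm, Nat.mul_add_mod, Nat.mod_eq_of_lt (show a < a + 2 by omega),
      Nat.mul_add_div (by omega), Nat.div_eq_of_lt (by omega)]
    simp
  rw [h1, ← h2]
  exact Nat.count_monotone _ hl

lemma minFaults_le_count (l : List Bool) : minFaults l ≤ l.count true := by
  match l with
  | [] => simp [minFaults_nil]
  | [true] => simp [minFaults, pairs11, remainingOnes]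
  | true :: true :: l =>
    have ih := minFaults_le_count l
    simp only [minFaults, pairs11, remainingOnes, List.count_cons_self] at ih ⊢
    omega
  | true :: false :: l =>
    have ih := minFaults_le_count l
    simp only [minFaults, pairs11, remainingOnes, List.count_cons_self, List.count_cons_of_ne,
      ne_eq, reduceCtorEq, not_false_eq_true] at ih ⊢
    omega
  | false :: l =>
    have ih := minFaults_le_count l
    simp only [minFaults, pairs11, remainingOnes, List.count_cons_of_ne, ne_eq, reduceCtorEq,
      not_false_eq_true] at ih ⊢
    omega

lemma two_mul_pairs11_le_count (l : List Bool) : 2 * pairs11 l ≤ l.count true := by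
  match l with
  | [] => simp [pairs11]
  | [true] => simp [pairs11]
  | true :: true :: l =>
    have ih := two_mul_pairs11_le_count l
    simp only [pairs11, List.count_cons_self] at ih ⊢
    omega
  | true :: false :: l =>
    have ih := two_mul_pairs11_le_count l
    simp only [pairs11, List.count_cons_self, List.count_cons_of_ne, ne_eq, reduceCtorEq,
      not_false_eq_true] at ih ⊢
    omega
  | false :: l =>
    have ih := two_mul_pairs11_le_count l
    simp only [pairs11, List.count_cons_of_ne, ne_eq, reduceCtorEq, not_false_eq_true] at ih ⊢
    omega

/-- With `k` ones in all, an end run has at most `a` zeros and loses one neighbouring one from the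
count, while an inner run has at most `a + 1` zeros and loses two. In both cases `α + β + γ ≤ k + a
- 1`. -/
lemma not_findsUsable_periodicString (a k : ℕ) (hk : 1 ≤ k) {l : ℕ} (hl : l + 1 = k * (a + 2) + a) :
    ¬ FindsUsable (k + a) (periodicString a l) := by
  rintro ⟨A, γ, B, hδ, hγ, hA, hB, ht⟩
  have hlen : l = A.length + γ + B.length := by
    rw [← length_periodicString a l, hδ]; simp [Nat.add_assoc]
  have hcount : A.count true + B.count true ≤ k := by
    have := count_periodicString_le a k l (by omega)
    rw [hδ, List.count_append, List.count_append, List.count_replicate] at this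
    simpa using this
  have hwin : ∀ i, A.length ≤ i → i < A.length + γ → i % (a + 2) ≠ a := by
    intro i h1 h2
    have h3 : (periodicString a l)[i]? = some false := by
      rw [hδ, List.getElem?_append_left (by simp; omega), List.getElem?_append_right h1,
        List.getElem?_replicate, if_pos (by omega)]
    simpa using periodicString_getElem? h3
  -- Any `a + 2` consecutive positions contain one congruent to `a`; the two cases locate it in the
  -- current period or in the next one.
  have hγ' : γ ≤ a + 1 := by
    by_contra! hlt
    have h1 := Nat.div_add_mod A.length (a + 2)
    have h2 := Nat.mod_lt A.length (show 0 < a + 2 by omega)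
    rcases Nat.lt_or_ge a (A.length % (a + 2)) with h3 | h3
    · refine hwin ((a + 2) * (A.length / (a + 2) + 1) + a) ?_ ?_ ?_
      · rw [Nat.mul_succ]; omega
      · rw [Nat.mul_succ]; omega
      · rw [Nat.mul_add_mod, Nat.mod_eq_of_lt (by omega)]
    · refine hwin ((a + 2) * (A.length / (a + 2)) + a) (by omega) (by omega) ?_
      rw [Nat.mul_add_mod, Nat.mod_eq_of_lt (by omega)]
  have hα : minFaults A.dropLast + (if A = [] then 0 else 1) ≤ A.count true := by
    rcases A.eq_nil_or_concat with rfl | ⟨A', b, rfl⟩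
    · simp [minFaults_nil]
    · have hb : b = true := by simpa using hA
      have := minFaults_le_count A'
      simp [hb]
      omega
  have hβ : minFaults B.tail + (if B = [] then 0 else 1) ≤ B.count true := by
    rcases B with _ | ⟨b, B⟩
    · simp [minFaults_nil]
    · have hb : b = true := by simpa using hB
      have := minFaults_le_count B
      simp [hb]
      omega
  have hγA : A = [] → γ ≤ a := by
    rintro rfl
    by_contra! hlt
    exact hwin a (by simp) (by simpa using hlt) (Nat.mod_eq_of_lt (by omega))
  obtain ⟨k', rfl⟩ := Nat.exists_eq_add_of_le' hk
  rw [Nat.succ_mul] at hl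
  have hγB : B = [] → γ ≤ a := by
    rintro rfl
    by_contra! hlt
    rw [List.length_nil] at hlen
    refine hwin (k' * (a + 2) + a) (by omega) (by omega) ?_
    rw [mul_comm, Nat.mul_add_mod, Nat.mod_eq_of_lt (by omega)]
  by_cases hA0 : A = [] <;> by_cases hB0 : B = []
  · have h1 := hγA hA0
    rw [hA0, hB0, List.length_nil] at hlen
    omega
  · have h1 := hγA hA0
    simp only [hB0, if_false] at hβ
    omega
  · have h1 := hγB hB0
    simp only [hA0, if_false] at hα
    omega
  · simp only [hA0, hB0, if_false] at hα hβ
    omega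

lemma not_stops_of_prefix_periodicString {a k : ℕ} (hk : 1 ≤ k) {l : ℕ}
    (hl : l + 1 = k * (a + 2) + a) {δ' : List Bool} (h : δ' <+: periodicString a l) :
    ¬ Stops (k + a) δ' := by
  rintro (h' | h')
  · exact not_findsUsable_periodicString a k hk hl (h'.of_prefix h)
  · have h1 := two_mul_pairs11_le_count δ'
    have h2 := h.sublist.count_le true
    have h3 := count_periodicString_le a k l (by omega)
    omega

/-- This is the balanced case of `le_numRounds`: `numRounds t + 1 = (k + 1) * (a + 2)` for `a = t /
2` and `k = t - a`. -/
lemma exists_numRounds_eq {t : ℕ} (ht : 1 ≤ t) :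
    ∃ a k, 1 ≤ k ∧ t = k + a ∧ a = t / 2 ∧ (numRounds t - 2) + 1 = k * (a + 2) + a := by
  refine ⟨t / 2, t - t / 2, by omega, by omega, rfl, ?_⟩
  unfold numRounds
  split_ifs with h
  · obtain ⟨u, rfl⟩ := h
    rw [show (2 * u + 1 + 3) / 2 = u + 2 by omega, show (2 * u + 1) / 2 = u by omega,
      show 2 * u + 1 - u = u + 1 by omega]
    have h1 : (u + 2) ^ 2 = (u + 1) * (u + 2) + u + 2 := by ring
    have h2 : 2 ≤ (u + 1) * (u + 2) := by nlinarith
    omega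
  · obtain ⟨u, rfl⟩ := Nat.not_odd_iff_even.1 h
    rw [show (u + u + 2) / 2 = u + 1 by omega, show (u + u + 4) / 2 = u + 2 by omega,
      show (u + u) / 2 = u by omega, show u + u - u = u by omega]
    have h1 : (u + 1) * (u + 2) = u * (u + 2) + u + 2 := by ring
    have h2 : 2 ≤ u * (u + 2) := by nlinarith
    omega

lemma diffVec_prefix {S : Type} [DecidableEq S] (s : ℕ → S) {N : ℕ} {δ' : List Bool}
    (h : δ' <+: diffVec s N) : δ' = diffVec s (δ'.length + 1) := by
  have hlen := h.length_le
  rw [length_diffVec] at hlen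
  have h1 := List.prefix_iff_eq_take.1 h
  conv_lhs => rw [h1]
  rw [diffVec, diffVec, ← List.map_take, List.take_range, Nat.add_sub_cancel, min_eq_left hlen]

lemma numRounds_le (t : ℕ) : (numRounds t : ℝ) ≤ ((t : ℝ) + 3) ^ 2 / 4 - 1 := by
  unfold numRounds
  split_ifs with h
  · obtain ⟨u, rfl⟩ := h
    rw [show (2 * u + 1 + 3) / 2 = u + 2 by omega, Nat.cast_sub (Nat.one_le_pow _ _ (by omega))]
    push_cast
    nlinarith
  · obtain ⟨u, rfl⟩ := Nat.not_odd_iff_even.1 h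
    rw [show (u + u + 2) / 2 = u + 1 by omega, show (u + u + 4) / 2 = u + 2 by omega,
      Nat.cast_sub (by nlinarith)]
    push_cast
    nlinarith

end AdaptiveShor

theorem theorem2 {n r : ℕ} (C : AdaptiveShor.StabilizerCode n r) (hd : 3 ≤ C.distance)
    (t : ℕ) (ht : t = (C.distance - 1) / 2) :
    -- with at most `numRounds t` rounds the protocol is strongly `t`-fault tolerant
    C.StronglyFaultTolerant t (C.adaptiveStrong t (AdaptiveShor.numRounds t)) ∧
    -- and it always stops: whatever syndromes are obtained, a condition to stop is satisfied
    -- after at most `numRounds t` rounds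
    (∀ s : ℕ → C.Syndrome, ∃ m, 1 ≤ m ∧ m ≤ AdaptiveShor.numRounds t ∧
      AdaptiveShor.Stops t (AdaptiveShor.diffVec s m)) ∧
    ((AdaptiveShor.numRounds t : ℝ) ≤ ((t : ℝ) + 3) ^ 2 / 4 - 1) ∧
    -- the longest difference vector on which the protocol has not stopped (at any round)
    IsGreatest {l : ℕ | ∃ δ : List Bool, δ.length = l ∧
        ∀ δ' : List Bool, δ' <+: δ → ¬ AdaptiveShor.Stops t δ'}
      (AdaptiveShor.numRounds t - 2) ∧
    -- for `t ≥ 2`, the longest difference vector with a zero but without usable zero substring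
    (2 ≤ t → IsGreatest {l : ℕ | ∃ δ : List Bool, δ.length = l ∧ false ∈ δ ∧
        ¬ AdaptiveShor.FindsUsable t δ}
      (AdaptiveShor.numRounds t - 2)) := by
  have ht1 : 1 ≤ t := by omega
  obtain ⟨a, k, hk, hta, hat, hN⟩ := AdaptiveShor.exists_numRounds_eq ht1
  refine ⟨?_, ?_, AdaptiveShor.numRounds_le t, ⟨?_, ?_⟩, fun ht2 => ⟨?_, ?_⟩⟩
  · rw [ht]
    exact AdaptiveShor.StabilizerCode.stronglyFaultTolerant_adaptiveStrong (by omega) _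
  · intro s
    -- All prefixes of the difference vector of `numRounds t` rounds are difference vectors of
    -- earlier rounds, so its length `numRounds t - 1` would violate the bound `numRounds t - 2`.
    by_contra! h
    have h1 := AdaptiveShor.length_add_two_le_numRounds_of_forall_prefix
      (δ := AdaptiveShor.diffVec s (AdaptiveShor.numRounds t)) fun δ' hδ' => by
        have h2 := hδ'.length_le
        rw [AdaptiveShor.length_diffVec] at h2
        rw [AdaptiveShor.diffVec_prefix s hδ']
        have h3 := AdaptiveShor.le_numRounds t 0
        exact h _ (by omega) (by rw [add_zero] at h3; omega)
    rw [AdaptiveShor.length_diffVec] at h1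
    omega
  · refine ⟨AdaptiveShor.periodicString a (AdaptiveShor.numRounds t - 2),
      AdaptiveShor.length_periodicString _ _, fun δ' hδ' => ?_⟩
    rw [hta] at hN hδ' ⊢
    exact AdaptiveShor.not_stops_of_prefix_periodicString hk hN hδ'
  · rintro l ⟨δ, rfl, hδ⟩
    have := AdaptiveShor.length_add_two_le_numRounds_of_forall_prefix hδ
    omega
  · refine ⟨AdaptiveShor.periodicString a (AdaptiveShor.numRounds t - 2),
      AdaptiveShor.length_periodicString _ _, ?_, ?_⟩
    -- Position 0 is a zero because `a = t / 2 ≥ 1`. For `t = 1` the extremal string is the single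
    -- letter `1`, hence the restriction to `t ≥ 2`.
    · have hpos : 0 < AdaptiveShor.numRounds t - 2 := by
        have : 1 * (a + 2) ≤ k * (a + 2) := Nat.mul_le_mul_right _ hk
        omega
      refine List.mem_map.2 ⟨0, List.mem_range.2 hpos, decide_eq_false fun h => ?_⟩
      rw [Nat.ModEq, Nat.zero_mod, Nat.mod_eq_of_lt (by omega)] at h
      omega
    · rw [hta] at hN ⊢
      exact AdaptiveShor.not_findsUsable_periodicString a k hk hN
  · rintro l ⟨δ, rfl, h0, hδ⟩
    have := AdaptiveShor.length_add_two_le_numRounds h0 hδ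
    omega
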